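/- Let $d\ge 1$ and $0<\rho^+\le 1$. Declare each vertex of $\mathbb{Z}^d$ frozen plus with probability $\rho^+$ and unfrozen with probability $1-\rho^+$, independently over the vertices (so the density of frozen minus vertices is $\rho^-=0$). Independently of this, attach to each vertex a rate $1$ Poisson process of clock rings and to each ring a fair $\pm1$ coin toss, all of these being independent. Given an arbitrary $\sigma'(0)\in\{-1,+1\}^{\mathbb{Z}^d}$, let $\sigma'(t)$, $t\ge 0$, be the following process. At the start the spins of the frozen vertices are replaced by their frozen value $+1$, and they never change afterwards. The spin of an unfrozen vertex changes only at the rings of its own clock; at each such ring it takes the value of the strict majority of its $2d$ nearest neighbors just before the ring, or the value of the coin attached to the ring if there is a tie. (The processes for all $\sigma'(0)$ use the same frozen vertices, clocks and coins.) Then, with probability one, simultaneously for every initial configuration $\sigma'(0)$, these rules determine a unique trajectory $(\sigma'(t))_{t\ge 0}$, and it fixates to $+1$ consensus: for every $x\in\mathbb{Z}^d$ there is a $T<\infty$ such that $\sigma'_x(t)=+1$ for all $t\ge T$. -/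

import Mathlib

open MeasureTheory ProbabilityTheory Filter Topology
open scoped NNReal

namespace FrozenMajority

/-- The vertices of the lattice `ℤ^d`. -/
abbrev Site (d : ℕ) : Type := Fin d → ℤ

/-- Spin configurations; the unit group `ℤˣ = {1, -1}` is the set of spin values. -/
abbrev Config (d : ℕ) : Type := Site d → ℤˣ

/-- The three types of vertices: frozen plus, frozen minus, unfrozen. -/
inductive VertexKind : Type
  | frozenPlus
  | frozenMinus
  | unfrozen

instance : MeasurableSpace VertexKind := ⊤

instance : DiscreteMeasurableSpace VertexKind := ⟨fun _ => trivial⟩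

/-- The sum of the spins of the `2 d` nearest neighbors `x ± e_i` of `x`. -/
def neighborSum {d : ℕ} (η : Config d) (x : Site d) : ℤ :=
  ∑ i : Fin d, ((η (x + Pi.single i 1) : ℤ) + (η (x - Pi.single i 1) : ℤ))

/-- The spin that an unfrozen vertex `x` takes when its clock rings in configuration `η`: the
value of the strict majority of its neighbors, or the value of the coin in case of a tie. -/
def majorityUpdate {d : ℕ} (η : Config d) (x : Site d) (coin : ℤˣ) : ℤˣ :=
  if 0 < neighborSum η x then 1 else if neighborSum η x < 0 then -1 else coin

/-- The initial spin at a vertex of the given kind: frozen vertices take their frozen value. -/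
def startSpin : VertexKind → ℤˣ → ℤˣ
  | .frozenPlus, _ => 1
  | .frozenMinus, _ => -1
  | .unfrozen, s => s

/-- `σ` is a trajectory of the dynamics with frozen vertices, for a fixed realization of the
randomness (the kinds of the vertices, the time `ring x k` of the `k`-th ring of the clock at `x`
and the coin `coin x k` attached to that ring), started from `σ₀` with the spins of the frozen
vertices replaced at once by their frozen values. -/
structure IsTrajectory {d : ℕ} (kind : Site d → VertexKind) (ring : Site d → ℕ → ℝ≥0)
    (coin : Site d → ℕ → ℤˣ) (σ₀ : Config d) (σ : ℝ≥0 → Config d) : Prop where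
  /-- The initial condition. -/
  initial : ∀ x, σ 0 x = startSpin (kind x) (σ₀ x)
  /-- Frozen vertices never change. -/
  frozen : ∀ x, kind x ≠ VertexKind.unfrozen → ∀ t, σ t x = σ 0 x
  /-- A spin does not change in a time interval `(s, t]` in which its clock does not ring. -/
  constant : ∀ x s t, s ≤ t → (∀ k, ring x k ∉ Set.Ioc s t) → σ t x = σ s x
  /-- When its clock rings, an unfrozen vertex is updated according to the spins of its neighbors
  just before the ring. -/
  update : ∀ x, kind x = VertexKind.unfrozen → ∀ k,
    ∀ᶠ s in 𝓝[<] (ring x k), σ (ring x k) x = majorityUpdate (σ s) x (coin x k)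

/-- Fixation to `+1` consensus: every vertex is `+1` from some finite time on. -/
def FixatesToPlus {d : ℕ} (σ : ℝ≥0 → Config d) : Prop :=
  ∀ x, ∃ T, ∀ t, T ≤ t → σ t x = 1

/-- The number of ring times in `[0, t]`. -/
noncomputable def ringCount (τ : ℕ → ℝ≥0) (t : ℝ≥0) : ℕ :=
  {k | τ k ≤ t}.ncard

/-- The random times `τ 0 < τ 1 < ...` are the ring times of a rate 1 Poisson process on
`(0, ∞)`: almost surely they are positive, increase strictly and tend to infinity, and the counting
process has independent increments, the one over `(s, t]` being Poisson with mean `t - s`. -/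
structure IsPoissonClock {Ω : Type*} [MeasurableSpace Ω] (P : Measure Ω) (τ : ℕ → Ω → ℝ≥0) :
    Prop where
  measurable : ∀ k, Measurable (τ k)
  pos : ∀ᵐ ω ∂P, 0 < τ 0 ω
  strictMono : ∀ᵐ ω ∂P, StrictMono (fun k => τ k ω)
  tendsto : ∀ᵐ ω ∂P, Tendsto (fun k => τ k ω) atTop atTop
  indep : HasIndepIncrements (fun t ω => ringCount (fun k => τ k ω) t) P
  law : ∀ s t : ℝ≥0, s ≤ t →
    HasLaw (fun ω => ringCount (fun k => τ k ω) t - ringCount (fun k => τ k ω) s)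
      (poissonMeasure (t - s)) P

/-- The randomness of the disordered process with densities `ρp` and `ρm` of frozen plus and
frozen minus vertices, on a probability space `(Ω, P)`: i.i.d. kinds of vertices, independent rate 1
Poisson clocks and i.i.d. fair coins (one for each ring), the three families being independent. -/
structure IsDisorderedEnvironment {Ω : Type*} [MeasurableSpace Ω] (P : Measure Ω) (d : ℕ)
    (ρp ρm : ℝ) (kind : Site d → Ω → VertexKind) (ring : Site d → ℕ → Ω → ℝ≥0)
    (coin : Site d → ℕ → Ω → ℤˣ) : Prop where
  measurable_kind : ∀ x, Measurable (kind x)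
  prob_plus : ∀ x, P.real {ω | kind x ω = VertexKind.frozenPlus} = ρp
  prob_minus : ∀ x, P.real {ω | kind x ω = VertexKind.frozenMinus} = ρm
  indep_kind : iIndepFun kind P
  clock : ∀ x, IsPoissonClock P (ring x)
  indep_clock : iIndepFun (fun x ω k => ring x k ω) P
  measurable_coin : ∀ x k, Measurable (coin x k)
  fair_coin : ∀ x k, P.real {ω | coin x k ω = 1} = 1 / 2
  indep_coin : iIndepFun (fun (p : Site d × ℕ) ω => coin p.1 p.2 ω) P
  indep_clock_coin : IndepFun (fun ω x k => ring x k ω) (fun ω x k => coin x k ω) P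
  indep_kind_dynamics : IndepFun (fun ω x => kind x ω)
    (fun ω => ((fun x k => ring x k ω), (fun x k => coin x k ω))) P

end FrozenMajority

/-! With no frozen minus vertices, the plus phase can spread like bootstrap percolation with
threshold `d`: an unfrozen site with at least `d` plus neighbors becomes plus at its next ring if
the coin is plus. The proof finds random boxes `[-n, n]^d` that are filled in this way from their
frozen plus sites alone and can never be lost again.

Spanning. By induction on `k`, a `k`-dimensional cube of side `M` with threshold `k` fails to be
internally spanned with probability `O(M ^ (-m))` for every `m` (`rapidlySpanned`). A site on a face
adjacent to a filled cube already has one plus neighbor, so on that face the threshold drops by one.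
If all faces are spanned, a filled cube can be moved around by unit steps and fills everything
(`FacesSpanned.subset`). A fully frozen nucleus therefore grows forever with positive probability,
and a large cube contains many independent nuclei. By Borel–Cantelli all large boxes are spanned,
and infinitely many of them have all corners frozen plus.

Stability. A site of the box that is not a corner has more than `d` neighbors in it. A box with
frozen corners that is plus once thus stays plus (`stays_plus`).

Filling. If every site of a spanned box rings in each of sufficiently many consecutive unit
intervals, with plus coins only, the box becomes plus, whatever happens outside
(`plus_of_isFillingWindow`). Almost surely such a window exists for each box and each length
(`ae_exists_isFillingWindow`).

Well-posedness. The value at a ring depends only on earlier rings at neighbors, so existence and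
uniqueness follow by well-founded recursion once there is no infinite backward chain of rings.
Harris' argument excludes one: in a short time slab the ringing sites form a subcritical percolation
(`ae_regularClocks`).

None of these events involves the initial configuration, so one null set serves all of them. -/

namespace FrozenMajority

section Bootstrap

variable {d : ℕ}

/-! ### Threshold bootstrap percolation on sub-cubes of the lattice -/

/-- The `2 d` nearest neighbors of a site, indexed by a coordinate direction and a sign. -/
def nb (x : Site d) (p : Fin d × Bool) : Site d :=
  if p.2 then x + Pi.single p.1 1 else x - Pi.single p.1 1

/-- The number of neighbors of `x` lying in `C`. -/
noncomputable def nbCount (C : Set (Site d)) (x : Site d) : ℕ :=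
  {p : Fin d × Bool | nb x p ∈ C}.ncard

/-- The set `C` is closed under bootstrap percolation in `B` with threshold `r`, started from the
sites of `F` in `B`. -/
structure IsClosedFor (F : Set (Site d)) (r : ℕ) (B C : Set (Site d)) : Prop where
  base : F ∩ B ⊆ C
  step : ∀ x ∈ B, r ≤ nbCount (C ∩ B) x → x ∈ C

/-- Bootstrap percolation in `B` with threshold `r` started from the sites of `F` in `B` fills
`B`. -/
def Spanned (F : Set (Site d)) (r : ℕ) (B : Set (Site d)) : Prop :=
  ∀ C, IsClosedFor F r B C → B ⊆ C

lemma nbCount_mono {C D : Set (Site d)} (h : C ⊆ D) (x : Site d) : nbCount C x ≤ nbCount D x :=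
  Set.ncard_le_ncard (fun _ hp => h hp) (Set.toFinite _)

lemma Spanned.mono {F F' B : Set (Site d)} {r : ℕ} (h : Spanned F r B) (hF : F ∩ B ⊆ F') :
    Spanned F' r B :=
  fun C hC => h C ⟨fun _ hx => hC.base ⟨hF hx, hx.2⟩, hC.step⟩

lemma spanned_congr {F F' B : Set (Site d)} {r : ℕ} (h : ∀ x ∈ B, x ∈ F ↔ x ∈ F') :
    Spanned F r B ↔ Spanned F' r B :=
  ⟨fun H => H.mono fun x hx => (h x hx.2).1 hx.1, fun H => H.mono fun x hx => (h x hx.2).2 hx.1⟩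

lemma spanned_of_subset {F B : Set (Site d)} {r : ℕ} (h : B ⊆ F) : Spanned F r B :=
  fun _ hC _ hx => hC.base ⟨h hx, hx⟩

/-- Only neighbors inside the region are counted, so closedness in `B` passes to `B'`. -/
lemma IsClosedFor.subset_of_spanned {F B B' C : Set (Site d)} {r : ℕ} (hC : IsClosedFor F r B C)
    (hB : B' ⊆ B) (h : Spanned F r B') : B' ⊆ C :=
  h C ⟨fun _ hx => hC.base ⟨hx.1, hB hx.2⟩, fun x hx hr => hC.step x (hB hx)
    (hr.trans (nbCount_mono (Set.inter_subset_inter_right _ hB) x))⟩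

/-- The cube with corner `z` and `M` sites along each direction in `S`, flat in the others. -/
def cube (z : Site d) (S : Finset (Fin d)) (M : ℕ) : Set (Site d) :=
  {x | (∀ i ∈ S, z i ≤ x i ∧ x i < z i + M) ∧ ∀ i ∉ S, x i = z i}

lemma self_mem_cube (z : Site d) (S : Finset (Fin d)) {M : ℕ} (hM : 1 ≤ M) : z ∈ cube z S M :=
  ⟨fun i _ => ⟨le_rfl, by omega⟩, fun _ _ => rfl⟩

lemma cube_subset_cube {z w : Site d} {S T : Finset (Fin d)} {M N : ℕ} (hS : S ⊆ T)
    (h₁ : ∀ i ∈ S, w i ≤ z i ∧ z i + M ≤ w i + N) (h₂ : ∀ i ∈ T, i ∉ S → w i ≤ z i ∧ z i < w i + N)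
    (h₃ : ∀ i ∉ T, z i = w i) : cube z S M ⊆ cube w T N := by
  intro x hx
  refine ⟨fun i hi => ?_, fun i hi => ?_⟩
  · by_cases hiS : i ∈ S
    · have := hx.1 i hiS
      have := h₁ i hiS
      omega
    · rw [hx.2 i hiS]
      exact h₂ i hi hiS
  · rw [hx.2 i (fun h => hi (hS h)), h₃ i hi]

lemma finite_cube (z : Site d) (S : Finset (Fin d)) (M : ℕ) : (cube z S M).Finite := by
  refine (Set.Finite.pi' (fun i : Fin d => Set.finite_Icc (z i) (z i + M))).subset ?_
  intro x hx i
  by_cases hi : i ∈ S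
  · have := hx.1 i hi
    exact ⟨this.1, this.2.le⟩
  · rw [hx.2 i hi]
    exact ⟨le_rfl, by omega⟩

lemma ncard_cube_le (z : Site d) (S : Finset (Fin d)) {M : ℕ} (hM : 1 ≤ M) :
    (cube z S M).ncard ≤ M ^ d := by
  have h : cube z S M ⊆
      (Fintype.piFinset fun i => Finset.Ico (z i) (z i + M) : Finset (Site d)) := by
    intro x hx
    rw [Finset.mem_coe, Fintype.mem_piFinset]
    intro i
    by_cases hi : i ∈ S
    · exact Finset.mem_Ico.2 (hx.1 i hi)
    · rw [hx.2 i hi, Finset.mem_Ico]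
      omega
  refine (Set.ncard_le_ncard h (Finset.finite_toSet _)).trans ?_
  rw [Set.ncard_coe_finset, Fintype.card_piFinset]
  simp

lemma spanned_cube_empty (F : Set (Site d)) (z : Site d) (M : ℕ) : Spanned F 0 (cube z ∅ M) :=
  fun _ hC x hx => hC.step x hx (Nat.zero_le _)

/-- A face of a cube adjacent to a filled cube gets filled as soon as it is spanned with a
threshold lower by one. -/
lemma IsClosedFor.face_subset {F B C : Set (Site d)} {S : Finset (Fin d)} {i : Fin d} (b : Bool)
    {w : Site d} {M : ℕ} (hi : i ∉ S) (hC : IsClosedFor F (S.card + 1) B C)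
    (hB : cube w S M ⊆ B) (hsp : Spanned F S.card (cube w S M))
    (hnb : ∀ x ∈ cube w S M, nb x (i, b) ∈ C ∩ B) : cube w S M ⊆ C := by
  refine hsp C ⟨fun _ hx => hC.base ⟨hx.1, hB hx.2⟩, fun x hx hr => hC.step x (hB hx) ?_⟩
  refine (Nat.succ_le_succ hr).trans ?_
  -- The neighbor in direction `i` is off the flat cube, so it comes in addition to those counted by
  -- `hr`.
  have hnot : (i, b) ∉ {p : Fin d × Bool | nb x p ∈ C ∩ cube w S M} := by
    rintro ⟨-, h⟩
    have h1 := h.2 i hi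
    have h2 := hx.2 i hi
    cases b <;> simp [nb] at h1 <;> omega
  have := Set.ncard_insert_of_notMem hnot (Set.toFinite _)
  unfold nbCount
  rw [Nat.succ_eq_add_one, ← this]
  refine Set.ncard_le_ncard ?_ (Set.toFinite _)
  rintro p (rfl | hp)
  · exact hnb x hx
  · exact ⟨hp.1, hB hp.2⟩

lemma mem_cube_add_single {z x : Site d} {S : Finset (Fin d)} {i : Fin d} {M : ℕ} (hi : i ∈ S)
    (hx : x ∈ cube (z + Pi.single i 1) S M) :
    x ∈ cube z S M ∨ x ∈ cube (z + Pi.single i (M : ℤ)) (S.erase i) M := by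
  have hxi := hx.1 i hi
  simp only [Pi.add_apply, Pi.single_eq_same] at hxi
  by_cases h : x i < z i + M
  · left
    refine ⟨fun j hj => ?_, fun j hj => ?_⟩
    · by_cases hji : j = i
      · subst hji; omega
      · simpa [hji] using hx.1 j hj
    · have hji : j ≠ i := fun e => hj (e ▸ hi)
      simpa [hji] using hx.2 j hj
  · right
    refine ⟨fun j hj => ?_, fun j hj => ?_⟩
    · rw [Finset.mem_erase] at hj
      simpa [hj.1] using hx.1 j hj.2
    · by_cases hji : j = i
      · subst hji
        simp; omega
      · simpa [hji] using hx.2 j (fun e => hj (Finset.mem_erase.2 ⟨hji, e⟩))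

lemma mem_cube_sub_single {z x : Site d} {S : Finset (Fin d)} {i : Fin d} {M : ℕ} (hi : i ∈ S)
    (hx : x ∈ cube (z - Pi.single i 1) S M) :
    x ∈ cube z S M ∨ x ∈ cube (z - Pi.single i 1) (S.erase i) M := by
  have hxi := hx.1 i hi
  simp only [Pi.sub_apply, Pi.single_eq_same] at hxi
  by_cases h : z i ≤ x i
  · left
    refine ⟨fun j hj => ?_, fun j hj => ?_⟩
    · by_cases hji : j = i
      · subst hji; omega
      · simpa [hji] using hx.1 j hj
    · have hji : j ≠ i := fun e => hj (e ▸ hi)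
      simpa [hji] using hx.2 j hj
  · right
    refine ⟨fun j hj => ?_, fun j hj => ?_⟩
    · rw [Finset.mem_erase] at hj
      simpa [hj.1] using hx.1 j hj.2
    · by_cases hji : j = i
      · subst hji
        simp; omega
      · simpa [hji] using hx.2 j (fun e => hj (Finset.mem_erase.2 ⟨hji, e⟩))

/-- All cubes of side `M` and of codimension one in `cube z S N` are spanned. -/
def FacesSpanned (F : Set (Site d)) (z : Site d) (S : Finset (Fin d)) (M N : ℕ) : Prop :=
  ∀ i ∈ S, ∀ w ∈ cube z S N, cube w (S.erase i) M ⊆ cube z S N →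
    Spanned F (S.erase i).card (cube w (S.erase i) M)

/-- The shifted cube gains only the face at coordinate `w i + M`. Each of its sites has its neighbor
in direction `-e_i` in the filled cube, so `face_subset` applies. -/
lemma FacesSpanned.add_single_subset {F C : Set (Site d)} {z w : Site d} {S : Finset (Fin d)}
    {M N : ℕ} (hM : 1 ≤ M) (h : FacesSpanned F z S M N)
    (hC : IsClosedFor F S.card (cube z S N) C) {i : Fin d} (hi : i ∈ S)
    (hw : cube w S M ⊆ C ∩ cube z S N) (hw' : cube (w + Pi.single i 1) S M ⊆ cube z S N) :
    cube (w + Pi.single i 1) S M ⊆ C := by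
  have hsub : cube (w + Pi.single i (M : ℤ)) (S.erase i) M ⊆ cube (w + Pi.single i 1) S M := by
    refine cube_subset_cube (Finset.erase_subset _ _) (fun j hj => ?_) (fun j hj hj' => ?_)
      (fun j hj => ?_)
    · have := (Finset.mem_erase.1 hj).1
      simp [this]
    · have : j = i := by by_contra e; exact hj' (Finset.mem_erase.2 ⟨e, hj⟩)
      subst this
      simp; omega
    · have : j ≠ i := fun e => hj (e ▸ hi)
      simp [this]
  have hcard : S.card = (S.erase i).card + 1 := (Finset.card_erase_add_one hi).symm
  have hface : cube (w + Pi.single i (M : ℤ)) (S.erase i) M ⊆ C := by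
    rw [hcard] at hC
    refine hC.face_subset false (Finset.notMem_erase i S) (hsub.trans hw')
      (h i hi _ (hw' (hsub (self_mem_cube _ _ hM))) (hsub.trans hw')) fun x hx => hw ?_
    refine ⟨fun j hj => ?_, fun j hj => ?_⟩
    · by_cases hji : j = i
      · subst hji
        have := hx.2 j (Finset.notMem_erase j S)
        simp [nb] at this ⊢; omega
      · simpa [nb, hji] using hx.1 j (Finset.mem_erase.2 ⟨hji, hj⟩)
    · have hji : j ≠ i := fun e => hj (e ▸ hi)
      simpa [nb, hji] using hx.2 j (fun e => hj (Finset.mem_of_mem_erase e))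
  intro x hx
  rcases mem_cube_add_single hi hx with hx | hx
  · exact (hw hx).1
  · exact hface hx

/-- Mirror image of `add_single_subset`: the new face is at coordinate `w i - 1`. -/
lemma FacesSpanned.sub_single_subset {F C : Set (Site d)} {z w : Site d} {S : Finset (Fin d)}
    {M N : ℕ} (hM : 1 ≤ M) (h : FacesSpanned F z S M N)
    (hC : IsClosedFor F S.card (cube z S N) C) {i : Fin d} (hi : i ∈ S)
    (hw : cube w S M ⊆ C ∩ cube z S N) (hw' : cube (w - Pi.single i 1) S M ⊆ cube z S N) :
    cube (w - Pi.single i 1) S M ⊆ C := by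
  have hsub : cube (w - Pi.single i 1) (S.erase i) M ⊆ cube (w - Pi.single i 1) S M := by
    refine cube_subset_cube (Finset.erase_subset _ _) (fun j hj => ?_) (fun j hj hj' => ?_)
      (fun j hj => ?_)
    · simp
    · have : j = i := by by_contra e; exact hj' (Finset.mem_erase.2 ⟨e, hj⟩)
      subst this
      simp; omega
    · rfl
  have hcard : S.card = (S.erase i).card + 1 := (Finset.card_erase_add_one hi).symm
  have hface : cube (w - Pi.single i 1) (S.erase i) M ⊆ C := by
    rw [hcard] at hC
    refine hC.face_subset true (Finset.notMem_erase i S) (hsub.trans hw')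
      (h i hi _ (hw' (hsub (self_mem_cube _ _ hM))) (hsub.trans hw')) fun x hx => hw ?_
    refine ⟨fun j hj => ?_, fun j hj => ?_⟩
    · by_cases hji : j = i
      · subst hji
        have := hx.2 j (Finset.notMem_erase j S)
        simp [nb] at this ⊢; omega
      · simpa [nb, hji] using hx.1 j (Finset.mem_erase.2 ⟨hji, hj⟩)
    · have hji : j ≠ i := fun e => hj (e ▸ hi)
      simpa [nb, hji] using hx.2 j (fun e => hj (Finset.mem_of_mem_erase e))
  intro x hx
  rcases mem_cube_sub_single hi hx with hx | hx
  · exact (hw hx).1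
  · exact hface hx

lemma cube_subset_cube_of_le {z w : Site d} {S : Finset (Fin d)} {M N : ℕ}
    (h : ∀ i ∈ S, z i ≤ w i ∧ w i + M ≤ z i + N) (h' : ∀ i ∉ S, w i = z i) :
    cube w S M ⊆ cube z S N :=
  cube_subset_cube subset_rfl h (fun _ hi hi' => absurd hi hi') h'

/-- If all faces of side `M` are spanned and a closed set contains one cube of side `M`, then it
contains everything. -/
lemma FacesSpanned.subset {F C : Set (Site d)} {z w : Site d} {S : Finset (Fin d)}
    {M N : ℕ} (hM : 1 ≤ M) (hMN : M ≤ N) (h : FacesSpanned F z S M N)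
    (hC : IsClosedFor F S.card (cube z S N) C)
    (hw : ∀ i ∈ S, z i ≤ w i ∧ w i + M ≤ z i + N) (hw' : ∀ i ∉ S, w i = z i)
    (hwC : cube w S M ⊆ C) : cube z S N ⊆ C := by
  -- Induction on the `ℓ¹` distance between the corners: each unit step towards `w` keeps the small
  -- cube inside the large one.
  have key : ∀ n : ℕ, ∀ u : Site d, (∑ i, (u i - w i).natAbs = n) →
      (∀ i ∈ S, z i ≤ u i ∧ u i + M ≤ z i + N) → (∀ i ∉ S, u i = z i) → cube u S M ⊆ C := by
    intro n
    induction n with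
    | zero =>
      intro u hu _ _
      have : u = w := by
        funext i
        have := (Finset.sum_eq_zero_iff.1 hu) i (Finset.mem_univ i)
        omega
      exact this ▸ hwC
    | succ n ih =>
      intro u hu h1 h2
      obtain ⟨i, -, hi⟩ : ∃ i ∈ Finset.univ, (u i - w i).natAbs ≠ 0 := by
        by_contra! hcon
        rw [Finset.sum_eq_zero hcon] at hu
        omega
      have hiS : i ∈ S := by
        by_contra e
        rw [h2 i e, hw' i e] at hi
        simp at hi
      have hsum : ∀ v : Site d, (∀ j, j ≠ i → v j = u j) →
          (v i - w i).natAbs + 1 = (u i - w i).natAbs → ∑ i, (v i - w i).natAbs = n := by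
        intro v hv hvi
        rw [← Finset.add_sum_erase _ _ (Finset.mem_univ i)] at hu ⊢
        have : ∑ j ∈ Finset.univ.erase i, (v j - w j).natAbs
            = ∑ j ∈ Finset.univ.erase i, (u j - w j).natAbs :=
          Finset.sum_congr rfl fun j hj => by rw [hv j (Finset.ne_of_mem_erase hj)]
        omega
      rcases lt_or_ge (w i) (u i) with hlt | hge
      · set v := u - Pi.single i 1 with hv
        have huv : u = v + Pi.single i 1 := by simp [hv]
        have hv1 : ∀ j ∈ S, z j ≤ v j ∧ v j + M ≤ z j + N := by
          intro j hj
          have h1j := h1 j hj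
          by_cases hji : j = i
          · subst hji
            have := hw j hj
            simp [hv]; omega
          · simpa [hv, hji] using h1j
        have hv2 : ∀ j ∉ S, v j = z j := by
          intro j hj
          have hji : j ≠ i := fun e => hj (e ▸ hiS)
          simpa [hv, hji] using h2 j hj
        have hvC := ih v (hsum v (fun j hj => by simp [hv, hj]) (by simp [hv]; omega)) hv1 hv2
        rw [huv]
        exact h.add_single_subset hM hC hiS
          (Set.subset_inter hvC (cube_subset_cube_of_le hv1 hv2))
          (huv ▸ cube_subset_cube_of_le h1 h2)
      · set v := u + Pi.single i 1 with hv
        have huv : u = v - Pi.single i 1 := by simp [hv]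
        have hv1 : ∀ j ∈ S, z j ≤ v j ∧ v j + M ≤ z j + N := by
          intro j hj
          have h1j := h1 j hj
          by_cases hji : j = i
          · subst hji
            have := hw j hj
            simp [hv]; omega
          · simpa [hv, hji] using h1j
        have hv2 : ∀ j ∉ S, v j = z j := by
          intro j hj
          have hji : j ≠ i := fun e => hj (e ▸ hiS)
          simpa [hv, hji] using h2 j hj
        have hvC := ih v (hsum v (fun j hj => by simp [hv, hj]) (by simp [hv]; omega)) hv1 hv2
        rw [huv]
        exact h.sub_single_subset hM hC hiS
          (Set.subset_inter hvC (cube_subset_cube_of_le hv1 hv2))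
          (huv ▸ cube_subset_cube_of_le h1 h2)
  intro x hx
  -- The small cube is placed with its corner at `x`, pushed back where it would stick out.
  refine key _ (fun i => min (x i) (z i + N - M)) rfl (fun i hi => ?_) (fun i hi => ?_)
    ⟨fun i hi => ?_, fun i hi => ?_⟩
  · have := hx.1 i hi
    omega
  · have := hx.2 i hi
    omega
  · have := hx.1 i hi
    simp only; omega
  · have := hx.2 i hi
    simp only; omega

lemma FacesSpanned.mono {F F' : Set (Site d)} {z : Site d} {S : Finset (Fin d)} {M N : ℕ}
    (h : FacesSpanned F z S M N) (hF : F ∩ cube z S N ⊆ F') : FacesSpanned F' z S M N :=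
  fun i hi w hw hsub => (h i hi w hw hsub).mono fun _ hx => hF ⟨hx.1, hsub hx.2⟩

lemma FacesSpanned.spanned {F : Set (Site d)} {z w : Site d} {S : Finset (Fin d)}
    {M N : ℕ} (hM : 1 ≤ M) (hMN : M ≤ N) (h : FacesSpanned F z S M N)
    (hw : ∀ i ∈ S, z i ≤ w i ∧ w i + M ≤ z i + N) (hw' : ∀ i ∉ S, w i = z i)
    (hsp : Spanned F S.card (cube w S M)) : Spanned F S.card (cube z S N) :=
  fun _ hC => h.subset hM hMN hC hw hw'
    (hC.subset_of_spanned (cube_subset_cube_of_le hw hw') hsp)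

/-- The occupied nucleus at the corner `z` grows by one unit of side length at a time. -/
lemma spanned_of_facesSpanned_succ {F : Set (Site d)} {z : Site d} {S : Finset (Fin d)}
    {L M : ℕ} (hL : 1 ≤ L) (hM : L ≤ M) (h₀ : cube z S L ⊆ F)
    (h : ∀ l ∈ Finset.Ico L M, FacesSpanned F z S l (l + 1)) :
    Spanned F S.card (cube z S M) := by
  induction M, hM using Nat.le_induction with
  | base => exact spanned_of_subset h₀
  | succ M hM ih =>
    exact (h M (Finset.mem_Ico.2 ⟨hM, Nat.lt_succ_self M⟩)).spanned (hL.trans hM) (Nat.le_succ M)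
      (fun i _ => ⟨le_rfl, by push_cast; omega⟩) (fun _ _ => rfl)
      (ih fun l hl => h l (Finset.Ico_subset_Ico_right (Nat.le_succ M) hl))

end Bootstrap

/-! ### Events determined by disjoint finite sets of independent variables -/

section Independence

variable {Ω ι β : Type*} [MeasurableSpace β] {Z : ι → Ω → β}

/-- The `σ`-algebra generated by the variables `Z i`, `i ∈ A`. -/
abbrev sigmaOn (Z : ι → Ω → β) (A : Finset ι) : MeasurableSpace Ω :=
  MeasurableSpace.comap (fun ω (i : A) => Z i ω) inferInstance

lemma sigmaOn_mono {A B : Finset ι} (h : A ⊆ B) : sigmaOn Z A ≤ sigmaOn Z B := by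
  rintro _ ⟨s, hs, rfl⟩
  refine ⟨(fun f (i : A) => f ⟨i, h i.2⟩) ⁻¹' s, ?_, rfl⟩
  exact hs.preimage (by fun_prop)

/-- All subsets of the countable space `A → β` are measurable, so it is enough that the event is
determined by the variables in `A`. -/
lemma measurableSet_sigmaOn [Countable β] [MeasurableSingletonClass β] {A : Finset ι} {E : Set Ω}
    (h : ∀ ω ω', (∀ i ∈ A, Z i ω = Z i ω') → ω ∈ E → ω' ∈ E) : MeasurableSet[sigmaOn Z A] E := by
  refine ⟨(fun ω (i : A) => Z i ω) '' E, (Set.to_countable _).measurableSet, ?_⟩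
  ext ω
  constructor
  · rintro ⟨ω', h', he⟩
    exact h ω' ω (fun i hi => congrFun he ⟨i, hi⟩) h'
  · exact fun h => ⟨ω, h, rfl⟩

variable [MeasurableSpace Ω] {P : Measure Ω}

lemma sigmaOn_le (hZ : ∀ i, Measurable (Z i)) (A : Finset ι) :
    sigmaOn Z A ≤ (inferInstance : MeasurableSpace Ω) :=
  Measurable.comap_le (measurable_pi_lambda _ fun i => hZ i)

lemma measure_inter_of_sigmaOn (hZ : ∀ i, Measurable (Z i)) (hind : iIndepFun Z P)
    {A B : Finset ι} (hAB : Disjoint A B) {E E' : Set Ω} (hE : MeasurableSet[sigmaOn Z A] E)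
    (hE' : MeasurableSet[sigmaOn Z B] E') : P (E ∩ E') = P E * P E' := by
  obtain ⟨s, hs, rfl⟩ := hE
  obtain ⟨t, ht, rfl⟩ := hE'
  exact (hind.indepFun_finset A B hAB hZ).measure_inter_preimage_eq_mul _ _ hs ht

lemma measureReal_iInter_compl_le [IsProbabilityMeasure P] (hZ : ∀ i, Measurable (Z i))
    (hind : iIndepFun Z P) {A : ℕ → Finset ι} (hA : Pairwise fun m n => Disjoint (A m) (A n))
    {E : ℕ → Set Ω} (hE : ∀ n, MeasurableSet[sigmaOn Z (A n)] (E n)) {q : ℝ}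
    (hq : ∀ n, q ≤ P.real (E n)) (K : ℕ) :
    P.real (⋂ n ∈ Finset.range K, (E n)ᶜ) ≤ (1 - q) ^ K := by
  classical
  induction K with
  | zero => simp
  | succ K ih =>
    have h1 : MeasurableSet[sigmaOn Z ((Finset.range K).biUnion A)]
        (⋂ n ∈ Finset.range K, (E n)ᶜ) := by
      refine MeasurableSet.biInter (Finset.range K).countable_toSet fun n hn => ?_
      exact sigmaOn_mono (Finset.subset_biUnion_of_mem A hn) _ (hE n).compl
    have hdis : Disjoint (A K) ((Finset.range K).biUnion A) := by
      rw [Finset.disjoint_biUnion_right]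
      exact fun n hn => hA (Finset.mem_range.1 hn).ne'
    have := measure_inter_of_sigmaOn hZ hind hdis (hE K).compl h1
    rw [Finset.range_add_one, Finset.set_biInter_insert, measureReal_def, this, ENNReal.toReal_mul,
      ← measureReal_def, ← measureReal_def, pow_succ',
      probReal_compl_eq_one_sub (sigmaOn_le hZ _ _ (hE K))]
    have h2 : P.real (E K) ≤ 1 := measureReal_le_one
    gcongr
    · have := hq K
      linarith
    · linarith [hq K]

lemma ae_exists_mem [IsProbabilityMeasure P] (hZ : ∀ i, Measurable (Z i))
    (hind : iIndepFun Z P) {A : ℕ → Finset ι} (hA : Pairwise fun m n => Disjoint (A m) (A n))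
    {E : ℕ → Set Ω} (hE : ∀ n, MeasurableSet[sigmaOn Z (A n)] (E n)) {q : ℝ} (hq0 : 0 < q)
    (hq : ∀ n, q ≤ P.real (E n)) : ∀ᵐ ω ∂P, ∃ n, ω ∈ E n := by
  have hq1 : q ≤ 1 := (hq 0).trans measureReal_le_one
  have h0 : P.real (⋂ n, (E n)ᶜ) ≤ 0 := by
    refine ge_of_tendsto' (tendsto_pow_atTop_nhds_zero_of_lt_one (r := 1 - q) (by linarith)
      (by linarith)) fun K => ?_
    refine (measureReal_mono ?_).trans (measureReal_iInter_compl_le hZ hind hA hE hq K)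
    exact Set.subset_iInter₂ fun n _ => Set.iInter_subset _ n
  have h1 : P (⋂ n, (E n)ᶜ) = 0 := by
    rw [measureReal_def, ENNReal.toReal_nonneg.ge_iff_eq', ENNReal.toReal_eq_zero_iff] at h0
    exact h0.resolve_right (measure_ne_top _ _)
  rw [ae_iff]
  convert h1 using 2
  ext ω
  simp

lemma ae_frequently_mem [IsProbabilityMeasure P] (hZ : ∀ i, Measurable (Z i))
    (hind : iIndepFun Z P) {A : ℕ → Finset ι} (hA : Pairwise fun m n => Disjoint (A m) (A n))
    {E : ℕ → Set Ω} (hE : ∀ n, MeasurableSet[sigmaOn Z (A n)] (E n)) {q : ℝ} (hq0 : 0 < q)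
    (hq : ∀ n, q ≤ P.real (E n)) : ∀ᵐ ω ∂P, ∃ᶠ n in atTop, ω ∈ E n := by
  have : ∀ N : ℕ, ∀ᵐ ω ∂P, ∃ n, ω ∈ E (N + n) := fun N =>
    ae_exists_mem hZ hind (A := fun n => A (N + n)) (fun m n h => hA (by omega))
      (fun n => hE (N + n)) hq0 (fun n => hq _)
  filter_upwards [ae_all_iff.2 this] with ω hω
  rw [frequently_atTop]
  intro N
  obtain ⟨n, hn⟩ := hω N
  exact ⟨N + n, by omega, hn⟩

lemma measureReal_forall_mem_eq [IsProbabilityMeasure P] (hind : iIndepFun Z P)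
    (A : Finset ι) {s : ι → Set β} (hs : ∀ i ∈ A, MeasurableSet (s i)) :
    P.real {ω | ∀ i ∈ A, Z i ω ∈ s i} = ∏ i ∈ A, P.real {ω | Z i ω ∈ s i} := by
  have := hind.measure_inter_preimage_eq_mul A hs
  have h2 : {ω | ∀ i ∈ A, Z i ω ∈ s i} = ⋂ i ∈ A, Z i ⁻¹' s i := by
    ext ω; simp
  rw [measureReal_def, h2, this, ENNReal.toReal_prod]
  rfl

end Independence

/-! ### Cubes are spanned with overwhelming probability -/

section Decay

variable {d : ℕ} {Ω : Type*} {X : Site d → Ω → Prop}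

lemma measurableSet_spanned (r : ℕ) {B : Set (Site d)} (hB : B.Finite) :
    MeasurableSet[sigmaOn X hB.toFinset] {ω | Spanned {x | X x ω} r B} := by
  refine measurableSet_sigmaOn fun ω ω' h h1 => ?_
  refine (spanned_congr fun x hx => ?_).1 h1
  simpa using h x (hB.mem_toFinset.2 hx)

variable [MeasurableSpace Ω] {P : Measure Ω} {ρ : ℝ}

/-- A polynomial bound of every order for the probability that a cube of dimension `k` is not
spanned. -/
def RapidlySpanned (P : Measure Ω) (X : Site d → Ω → Prop) (k : ℕ) : Prop :=
  ∀ m : ℕ, ∃ C : ℝ, 0 ≤ C ∧ ∀ S : Finset (Fin d), S.card = k → ∀ z : Site d, ∀ M : ℕ, 1 ≤ M →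
    P.real {ω | ¬ Spanned {x | X x ω} S.card (cube z S M)} ≤ C / M ^ m

/-- Union bound over at most `d` directions and `N ^ d` corners. -/
lemma measureReal_not_facesSpanned_le [IsProbabilityMeasure P] {k m : ℕ} {C : ℝ}
    (hC : ∀ S : Finset (Fin d), S.card = k → ∀ z : Site d, ∀ M : ℕ, 1 ≤ M →
      P.real {ω | ¬ Spanned {x | X x ω} S.card (cube z S M)} ≤ C / M ^ m) (hC0 : 0 ≤ C)
    {S : Finset (Fin d)} (hS : S.card = k + 1) (z : Site d) {M N : ℕ} (hM : 1 ≤ M) (hN : 1 ≤ N) :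
    P.real {ω | ¬ FacesSpanned {x | X x ω} z S M N} ≤ d * N ^ d * (C / M ^ m) := by
  set T := S ×ˢ (finite_cube z S N).toFinset with hT
  have hsub : {ω | ¬ FacesSpanned {x | X x ω} z S M N} ⊆
      ⋃ p ∈ T, {ω | ¬ Spanned {x | X x ω} (S.erase p.1).card (cube p.2 (S.erase p.1) M)} := by
    intro ω hω
    simp only [Set.mem_ofPred_eq, FacesSpanned, not_forall] at hω
    obtain ⟨i, hi, w, hw, -, h⟩ := hω
    simp only [Set.mem_iUnion]
    exact ⟨(i, w), Finset.mem_product.2 ⟨hi, (finite_cube z S N).mem_toFinset.2 hw⟩, h⟩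
  refine (measureReal_mono hsub (measure_ne_top _ _)).trans ((measureReal_biUnion_finset_le _ _).trans ?_)
  refine (Finset.sum_le_card_nsmul T _ (C / (M : ℝ) ^ m) fun p hp => ?_).trans ?_
  · refine hC _ ?_ p.2 M hM
    rw [Finset.card_erase_of_mem (Finset.mem_product.1 hp).1, hS]
    rfl
  · rw [nsmul_eq_mul]
    have h1 : T.card ≤ d * N ^ d := by
      rw [hT, Finset.card_product, ← Set.ncard_eq_toFinset_card _ (finite_cube z S N)]
      exact Nat.mul_le_mul (by simpa using Finset.card_le_univ S) (ncard_cube_le z S hN)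
    have h2 : (T.card : ℝ) ≤ d * N ^ d := by exact_mod_cast h1
    gcongr

lemma measureReal_subset_ge [IsProbabilityMeasure P] (hind : iIndepFun X P)
    (hρ : ∀ x, P.real {ω | X x ω} = ρ) (B : Finset (Site d)) :
    P.real {ω | ∀ x ∈ B, X x ω} = ρ ^ B.card := by
  have := measureReal_forall_mem_eq hind B (s := fun _ => {p | p}) (fun _ _ => trivial)
  simpa [hρ] using this

/-- The probability that a cube is spanned is bounded below uniformly in its size. -/
lemma exists_le_measureReal_spanned [IsProbabilityMeasure P] (hX : ∀ x, Measurable (X x))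
    (hind : iIndepFun X P) (hρ0 : 0 < ρ) (hρ : ∀ x, P.real {ω | X x ω} = ρ) {k : ℕ}
    (hk : RapidlySpanned P X k) : ∃ q : ℝ, 0 < q ∧ ∀ S : Finset (Fin d), S.card = k + 1 →
      ∀ z : Site d, ∀ M : ℕ, 1 ≤ M → q ≤ P.real {ω | Spanned {x | X x ω} S.card (cube z S M)} := by
  classical
  -- Of the exponent `d + 2`, the part `d` absorbs the number of faces and the rest leaves a
  -- summable `l ^ (-2)`; `L` then makes the tail at most `1 / 2`.
  obtain ⟨C, hC0, hC⟩ := hk (d + 2)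
  obtain ⟨L, hL1, hL⟩ : ∃ L : ℕ, 1 ≤ L ∧ (d * 2 ^ d * C) * (2 / L) ≤ 1 / 2 := by
    obtain ⟨L, hL⟩ := exists_nat_ge (4 * (d * 2 ^ d * C))
    refine ⟨L + 1, by omega, ?_⟩
    rw [mul_div_assoc', div_le_div_iff₀ (by positivity) (by norm_num)]
    push_cast
    linarith
  have hρ1 : ρ ≤ 1 := by rw [← hρ 0]; exact measureReal_le_one
  refine ⟨ρ ^ (L ^ d) / 2, by positivity, fun S hS z M hM => ?_⟩
  set Q := (finite_cube z S L).toFinset with hQ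
  set A := {ω | ∀ x ∈ Q, X x ω} with hA
  -- Declaring the nucleus occupied makes `G` depend only on sites outside it, hence independent of
  -- `A`; on `A` the change is invisible.
  set G := ⋂ l ∈ Finset.Ico L M,
    {ω | FacesSpanned ({x | X x ω} ∪ cube z S L) z S l (l + 1)} with hG
  have hAG : A ∩ G ⊆ {ω | Spanned {x | X x ω} S.card (cube z S M)} := by
    rintro ω ⟨hωA, hωG⟩
    have h0 : cube z S L ⊆ {x | X x ω} := fun x hx =>
      hωA x ((finite_cube z S L).mem_toFinset.2 hx)
    rcases le_or_gt M L with hML | hML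
    · refine spanned_of_subset (subset_trans ?_ h0)
      exact cube_subset_cube_of_le (fun _ _ => ⟨le_rfl, by omega⟩) (fun _ _ => rfl)
    · refine spanned_of_facesSpanned_succ hL1 hML.le h0 fun l hl => ?_
      have := Set.mem_iInter₂.1 hωG l hl
      rwa [Set.mem_ofPred_eq, Set.union_eq_self_of_subset_right h0] at this
  have hAm : MeasurableSet[sigmaOn X Q] A :=
    measurableSet_sigmaOn fun ω ω' h h1 x hx => h x hx ▸ h1 x hx
  have hGm : MeasurableSet[sigmaOn X ((finite_cube z S M).toFinset \ Q)] G := by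
    refine measurableSet_sigmaOn fun ω ω' h h1 => ?_
    refine Set.mem_iInter₂.2 fun l hl => (Set.mem_iInter₂.1 h1 l hl).mono ?_
    rintro x ⟨hx | hx, hxc⟩
    · by_cases hxQ : x ∈ cube z S L
      · exact Or.inr hxQ
      · refine Or.inl ?_
        have hxM : x ∈ cube z S M := cube_subset_cube_of_le
          (fun _ _ => ⟨le_rfl, by have := (Finset.mem_Ico.1 hl).2; omega⟩) (fun _ _ => rfl) hxc
        have := h x (by simp [hQ, hxQ, hxM])
        rw [Set.mem_ofPred_eq] at hx ⊢
        exact this ▸ hx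
    · exact Or.inr hx
  have hGc : P.real Gᶜ ≤ 1 / 2 := by
    have h1 : Gᶜ ⊆ ⋃ l ∈ Finset.Ico L M, {ω | ¬ FacesSpanned {x | X x ω} z S l (l + 1)} := by
      intro ω hω
      rw [hG, Set.compl_iInter₂] at hω
      obtain ⟨l, hl, h⟩ := Set.mem_iUnion₂.1 hω
      exact Set.mem_iUnion₂.2 ⟨l, hl, fun h' => h (h'.mono fun x hx => Or.inl hx.1)⟩
    refine (measureReal_mono h1 (measure_ne_top _ _)).trans ((measureReal_biUnion_finset_le _ _).trans ?_)
    calc ∑ l ∈ Finset.Ico L M, P.real {ω | ¬ FacesSpanned {x | X x ω} z S l (l + 1)}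
        ≤ ∑ l ∈ Finset.Ico L M, (d * 2 ^ d * C) * ((l : ℝ) ^ 2)⁻¹ := by
          refine Finset.sum_le_sum fun l hl => ?_
          have hl1 : 1 ≤ l := hL1.trans (Finset.mem_Ico.1 hl).1
          refine (measureReal_not_facesSpanned_le hC hC0 hS z hl1 (by omega)).trans ?_
          have hl0 : (1 : ℝ) ≤ l := by exact_mod_cast hl1
          have h2 : ((l + 1 : ℕ) : ℝ) ^ d ≤ 2 ^ d * l ^ d := by
            rw [← mul_pow]
            gcongr
            push_cast
            linarith
          calc (d : ℝ) * ((l + 1 : ℕ) : ℝ) ^ d * (C / l ^ (d + 2))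
              ≤ d * (2 ^ d * l ^ d) * (C / l ^ (d + 2)) := by gcongr
            _ = (d * 2 ^ d * C) * ((l : ℝ) ^ 2)⁻¹ := by
              rw [pow_add]
              field_simp
      _ = (d * 2 ^ d * C) * ∑ l ∈ Finset.Ioo (L - 1) M, ((l : ℝ) ^ 2)⁻¹ := by
          rw [Finset.mul_sum]
          congr 1
          ext l
          simp only [Finset.mem_Ico, Finset.mem_Ioo]
          omega
      _ ≤ (d * 2 ^ d * C) * (2 / L) := by
          have := sum_Ioo_inv_sq_le (α := ℝ) (L - 1) M
          rw [← Nat.cast_add_one, Nat.sub_add_cancel hL1] at this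
          gcongr
      _ ≤ 1 / 2 := hL
  have hGp : 1 / 2 ≤ P.real G := by
    have := probReal_compl_eq_one_sub (μ := P) (sigmaOn_le hX _ _ hGm)
    linarith
  have hAp : ρ ^ (L ^ d) ≤ P.real A := by
    rw [hA, measureReal_subset_ge hind hρ]
    refine pow_le_pow_of_le_one hρ0.le hρ1 ?_
    rw [hQ, ← Set.ncard_eq_toFinset_card _ (finite_cube z S L)]
    exact ncard_cube_le z S hL1
  calc ρ ^ (L ^ d) / 2 = ρ ^ (L ^ d) * (1 / 2) := by ring
    _ ≤ P.real A * P.real G := by gcongr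
    _ = P.real (A ∩ G) := by
      rw [measureReal_def, measureReal_def, measureReal_def, ← ENNReal.toReal_mul,
        measure_inter_of_sigmaOn hX hind Finset.disjoint_sdiff hAm hGm]
    _ ≤ _ := measureReal_mono hAG

lemma exists_pow_le_div_pow {r : ℝ} (hr0 : 0 ≤ r) (hr : r < 1) (m : ℕ) :
    ∃ C : ℝ, 0 ≤ C ∧ ∀ n : ℕ, 1 ≤ n → r ^ n ≤ C / n ^ m := by
  have h := tendsto_pow_const_mul_const_pow_of_abs_lt_one m (by rwa [abs_of_nonneg hr0])
  obtain ⟨C, hC⟩ := h.bddAbove_range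
  refine ⟨C, ?_, fun n hn => ?_⟩
  · exact le_trans (by positivity) (hC ⟨0, rfl⟩)
  · rw [le_div_iff₀ (by positivity), mul_comm]
    exact hC ⟨n, rfl⟩

/-- With `M` about `√N`, a cube of side `N` contains `M` disjoint cubes of side `M`. All of them
fail with probability exponentially small in `M`, and one success suffices when the faces of side
`M` are spanned. -/
lemma RapidlySpanned.succ [IsProbabilityMeasure P] (hX : ∀ x, Measurable (X x))
    (hind : iIndepFun X P) (hρ0 : 0 < ρ) (hρ : ∀ x, P.real {ω | X x ω} = ρ) {k : ℕ}
    (hk : RapidlySpanned P X k) : RapidlySpanned P X (k + 1) := by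
  classical
  intro m
  obtain ⟨q, hq0, hq⟩ := exists_le_measureReal_spanned hX hind hρ0 hρ hk
  -- The factor `2` compensates for `M ≈ √N`, and `d` for the `N ^ d` faces.
  obtain ⟨C, hC0, hC⟩ := hk (2 * (d + m))
  -- The maximum is taken because `q ≤ 1` is known only once some `S` of this size is given.
  obtain ⟨C', hC'0, hC'⟩ := exists_pow_le_div_pow (r := max (1 - q) 0) (le_max_right _ _)
    (max_lt (by linarith) one_pos) (2 * m)
  refine ⟨d * C * 4 ^ (d + m) + C' * 4 ^ m, by positivity, fun S hS z N hN => ?_⟩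
  set M := Nat.sqrt N with hM
  have hM1 : 1 ≤ M := Nat.sqrt_pos.2 hN
  have hMN : M * M ≤ N := Nat.sqrt_le N
  have hNM : N ≤ 4 * (M * M) := by
    have := Nat.lt_succ_sqrt N
    rw [← hM, Nat.succ_eq_add_one] at this
    nlinarith
  obtain ⟨i, hi⟩ : S.Nonempty := Finset.card_pos.1 (by omega)
  set w : ℕ → Site d := fun j => z + Pi.single i ((j * M : ℕ) : ℤ) with hw
  set E : ℕ → Set Ω := fun j => {ω | Spanned {x | X x ω} S.card (cube (w j) S M)} with hE
  have hqE : ∀ j, q ≤ P.real (E j) := fun j => hq S hS (w j) M hM1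
  have hq1 : q ≤ 1 := (hqE 0).trans measureReal_le_one
  have hdis : Pairwise fun j l => Disjoint (finite_cube (w j) S M).toFinset
      (finite_cube (w l) S M).toFinset := by
    intro j l hjl
    rw [Set.Finite.disjoint_toFinset, Set.disjoint_left]
    intro x hx hx'
    have h1 := hx.1 i hi
    have h2 := hx'.1 i hi
    simp only [hw, Pi.add_apply, Pi.single_eq_same] at h1 h2
    push_cast at h1 h2
    rcases lt_or_gt_of_ne hjl with h | h
    · have : ((j : ℤ) + 1) * M ≤ l * M := by
        have : (j : ℤ) + 1 ≤ l := by exact_mod_cast h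
        gcongr
      linarith
    · have : ((l : ℤ) + 1) * M ≤ j * M := by
        have : (l : ℤ) + 1 ≤ j := by exact_mod_cast h
        gcongr
      linarith
  have hsub : {ω | ¬ Spanned {x | X x ω} S.card (cube z S N)} ⊆
      {ω | ¬ FacesSpanned {x | X x ω} z S M N} ∪ ⋂ j ∈ Finset.range M, (E j)ᶜ := by
    intro ω hω
    by_contra hcon
    rw [Set.mem_union, not_or] at hcon
    obtain ⟨h1, h2⟩ := hcon
    simp only [Set.mem_iInter, not_forall, Set.mem_compl_iff, not_not, Set.mem_ofPred_eq] at h1 h2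
    obtain ⟨j, hj, h3⟩ := h2
    refine hω (h1.spanned hM1 (Nat.sqrt_le_self N) (fun l hl => ?_) (fun l hl => ?_) h3)
    · by_cases hli : l = i
      · subst hli
        have : (j + 1) * M ≤ M * M := Nat.mul_le_mul_right _ (Finset.mem_range.1 hj)
        simp only [hw, Pi.add_apply, Pi.single_eq_same]
        have h4 : j * M + M ≤ N := by linarith
        omega
      · have := Nat.sqrt_le_self N
        simp only [hw, Pi.add_apply, Pi.single_eq_of_ne hli]
        omega
    · have hli : l ≠ i := fun e => hl (e ▸ hi)
      simp [hw, hli]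
  have hN0 : (0 : ℝ) < N := by exact_mod_cast hN
  have hM0 : (0 : ℝ) < M := by exact_mod_cast hM1
  have hpow : ∀ r : ℕ, ((M : ℝ) ^ (2 * r))⁻¹ ≤ 4 ^ r / N ^ r := by
    intro r
    rw [← div_pow, pow_mul, ← inv_pow]
    refine pow_le_pow_left₀ (by positivity) ?_ r
    rw [inv_le_comm₀ (by positivity) (by positivity), inv_div, div_le_iff₀ (by norm_num)]
    have : (N : ℝ) ≤ 4 * (M * M) := by exact_mod_cast hNM
    linarith
  calc P.real {ω | ¬ Spanned {x | X x ω} S.card (cube z S N)}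
      ≤ P.real {ω | ¬ FacesSpanned {x | X x ω} z S M N}
        + P.real (⋂ j ∈ Finset.range M, (E j)ᶜ) :=
        (measureReal_mono hsub).trans (measureReal_union_le _ _)
    _ ≤ d * N ^ d * (C / M ^ (2 * (d + m))) + C' / M ^ (2 * m) := by
        gcongr
        · exact measureReal_not_facesSpanned_le hC hC0 hS z hM1 hN
        · refine (measureReal_iInter_compl_le hX hind hdis
            (fun j => measurableSet_spanned _ _) hqE M).trans (le_trans ?_ (hC' M hM1))
          exact pow_le_pow_left₀ (by linarith) (le_max_left _ _) M
    _ ≤ d * N ^ d * (C * (4 ^ (d + m) / N ^ (d + m))) + C' * (4 ^ m / N ^ m) := by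
        rw [div_eq_mul_inv C, div_eq_mul_inv C']
        gcongr
        · exact hpow _
        · exact hpow _
    _ = (d * C * 4 ^ (d + m) + C' * 4 ^ m) / N ^ m := by
        rw [pow_add (N : ℝ)]
        field_simp

theorem rapidlySpanned [IsProbabilityMeasure P] (hX : ∀ x, Measurable (X x))
    (hind : iIndepFun X P) (hρ0 : 0 < ρ) (hρ : ∀ x, P.real {ω | X x ω} = ρ) (k : ℕ) :
    RapidlySpanned P X k := by
  induction k with
  | zero =>
    refine fun m => ⟨0, le_rfl, fun S hS z M hM => ?_⟩
    obtain rfl := Finset.card_eq_zero.1 hS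
    simp [spanned_cube_empty]
  | succ k ih => exact ih.succ hX hind hρ0 hρ

/-- The box `[-n, n]^d`. -/
def box (d n : ℕ) : Set (Site d) := cube (fun _ => -(n : ℤ)) Finset.univ (2 * n + 1)

lemma mem_box {n : ℕ} {x : Site d} : x ∈ box d n ↔ ∀ i, -(n : ℤ) ≤ x i ∧ x i ≤ n := by
  simp only [box, cube, Set.mem_ofPred_eq, Finset.mem_univ, not_true, IsEmpty.forall_iff,
    implies_true, and_true, true_implies]
  refine forall_congr' fun i => ?_
  push_cast
  constructor <;> intro h <;> omega

/-- The corners of the box `[-n, n]^d`. -/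
def corners (d n : ℕ) : Finset (Site d) := Fintype.piFinset fun _ => {(n : ℤ), -(n : ℤ)}

lemma mem_corners {n : ℕ} {x : Site d} : x ∈ corners d n ↔ ∀ i, x i = n ∨ x i = -n := by
  simp [corners]

/-- Almost surely there are arbitrarily large spanned boxes all of whose corners belong to the
random set. -/
theorem ae_exists_spanned_box [IsProbabilityMeasure P] (hd : 1 ≤ d) (hX : ∀ x, Measurable (X x))
    (hind : iIndepFun X P) (hρ0 : 0 < ρ) (hρ : ∀ x, P.real {ω | X x ω} = ρ) :
    ∀ᵐ ω ∂P, ∀ N, ∃ n ≥ N, Spanned {x | X x ω} d (box d n) ∧ ∀ x ∈ corners d n, X x ω := by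
  have hρ1 : ρ ≤ 1 := by rw [← hρ 0]; exact measureReal_le_one
  -- Since `1 ≤ d`, boxes of different sizes have disjoint corner sets, so these events are
  -- independent.
  have h1 : ∀ᵐ ω ∂P, ∃ᶠ n in atTop, ω ∈ {ω | ∀ x ∈ corners d n, X x ω} := by
    refine ae_frequently_mem hX hind (A := corners d) (fun m n hmn => ?_) (fun n => ?_)
      (q := ρ ^ (2 ^ d)) (by positivity) (fun n => ?_)
    · refine Finset.disjoint_left.2 fun x hx hx' => ?_
      have := mem_corners.1 hx ⟨0, hd⟩
      have := mem_corners.1 hx' ⟨0, hd⟩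
      omega
    · exact measurableSet_sigmaOn fun ω ω' h h1 x hx => h x hx ▸ h1 x hx
    · rw [measureReal_subset_ge hind hρ]
      refine pow_le_pow_of_le_one hρ0.le hρ1 ?_
      rw [corners, Fintype.card_piFinset]
      refine (Finset.prod_le_pow_card _ _ 2 fun _ _ => Finset.card_le_two).trans ?_
      simp
  obtain ⟨C, hC0, hC⟩ := rapidlySpanned hX hind hρ0 hρ d 2
  have h2 : ∀ᵐ ω ∂P, ∀ᶠ n in atTop, ω ∉ {ω | ¬ Spanned {x | X x ω} d (box d n)} := by
    refine ae_eventually_notMem (ne_top_of_le_ne_top ENNReal.ofReal_ne_top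
      (b := ENNReal.ofReal (∑' n : ℕ, C / ((n : ℝ) + 1) ^ 2)) ?_)
    have hs : Summable fun n : ℕ => C / ((n : ℝ) + 1) ^ 2 := by
      have := (summable_nat_add_iff 1).2 (Real.summable_one_div_nat_pow.2 one_lt_two)
      simpa [div_eq_mul_inv] using this.mul_left C
    rw [ENNReal.ofReal_tsum_of_nonneg (fun n => by positivity) hs]
    refine ENNReal.tsum_le_tsum fun n => ?_
    have h3 := hC Finset.univ (by simp) (fun _ => -(n : ℤ)) (2 * n + 1) (by omega)
    rw [Finset.card_univ, Fintype.card_fin] at h3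
    rw [← ofReal_measureReal]
    refine ENNReal.ofReal_le_ofReal (h3.trans ?_)
    gcongr
    push_cast
    have : (0 : ℝ) ≤ n := by positivity
    linarith
  filter_upwards [h1, h2] with ω hω1 hω2 N
  obtain ⟨n, hn, h3, h4⟩ := (hω1.and_eventually (hω2.and (eventually_ge_atTop N))).exists
  exact ⟨n, h4, not_not.1 h3, hn⟩

end Decay

/-! ### Counting the rings of a deterministic clock -/

section Count

/-- The number of rings up to time `t`, the last instant included. -/
noncomputable def numLE (τ : ℕ → ℝ≥0) (t : ℝ≥0) : ℕ := sInf {k | t < τ k}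

/-- The number of rings strictly before time `t`. -/
noncomputable def numLT (τ : ℕ → ℝ≥0) (t : ℝ≥0) : ℕ := sInf {k | t ≤ τ k}

variable {τ : ℕ → ℝ≥0}

lemma lt_numLE_iff (hm : StrictMono τ) (ht : Tendsto τ atTop atTop) {t : ℝ≥0} {j : ℕ} :
    j < numLE τ t ↔ τ j ≤ t := by
  have hne : {k | t < τ k}.Nonempty := (ht.eventually_gt_atTop t).exists
  constructor
  · intro h
    by_contra! hc
    exact absurd (Nat.sInf_le (show j ∈ {k | t < τ k} from hc)) (not_le.2 h)
  · intro h
    by_contra! hc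
    exact absurd ((Nat.sInf_mem hne).trans_le (hm.monotone hc)) (not_lt.2 h)

lemma lt_numLT_iff (hm : StrictMono τ) (ht : Tendsto τ atTop atTop) {t : ℝ≥0} {j : ℕ} :
    j < numLT τ t ↔ τ j < t := by
  have hne : {k | t ≤ τ k}.Nonempty := (ht.eventually_ge_atTop t).exists
  constructor
  · intro h
    by_contra! hc
    exact absurd (Nat.sInf_le (show j ∈ {k | t ≤ τ k} from hc)) (not_le.2 h)
  · intro h
    by_contra! hc
    exact absurd ((show t ≤ τ (numLT τ t) from Nat.sInf_mem hne).trans (hm.monotone hc))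
      (not_le.2 h)

lemma numLE_eq_of_forall_iff (hm : StrictMono τ) (ht : Tendsto τ atTop atTop) {t : ℝ≥0} {n : ℕ}
    (h : ∀ j, j < n ↔ τ j ≤ t) : numLE τ t = n := by
  refine eq_of_forall_lt_iff fun j => ?_
  rw [lt_numLE_iff hm ht, h]

/-- Only finitely many rings precede `t`, so the count is constant from the last of them until `t`.
-/
lemma eventually_numLE_eq (hm : StrictMono τ) (ht : Tendsto τ atTop atTop) (t : ℝ≥0) :
    ∀ᶠ s in 𝓝[<] t, numLE τ s = numLT τ t := by
  have h : ∀ᶠ s in 𝓝[<] t, ∀ j ∈ Finset.range (numLT τ t), τ j < s := by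
    rw [Finset.eventually_all]
    intro j hj
    rw [Finset.mem_range, lt_numLT_iff hm ht] at hj
    exact eventually_nhdsWithin_of_eventually_nhds (lt_mem_nhds hj)
  filter_upwards [h, self_mem_nhdsWithin] with s hs hst
  refine numLE_eq_of_forall_iff hm ht fun j => ⟨fun hj => (hs j (Finset.mem_range.2 hj)).le, ?_⟩
  exact fun hj => (lt_numLT_iff hm ht).2 (hj.trans_lt hst)

end Count

/-! ### Trajectories for regular clocks -/

section Dynamics

variable {d : ℕ} {kind : Site d → VertexKind} {ring : Site d → ℕ → ℝ≥0}
  {coin : Site d → ℕ → ℤˣ} {σ₀ : Config d}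

/-- The ring `q` occurs at a neighbor of the site of the ring `p`, and before `p`. -/
def Precedes (ring : Site d → ℕ → ℝ≥0) (q p : Site d × ℕ) : Prop :=
  (∃ b, q.1 = nb p.1 b) ∧ ring q.1 q.2 < ring p.1 p.2

/-- The properties of the clocks under which the dynamics is well defined. -/
structure RegularClocks (ring : Site d → ℕ → ℝ≥0) : Prop where
  pos : ∀ x, 0 < ring x 0
  strictMono : ∀ x, StrictMono (ring x)
  tendsto : ∀ x, Tendsto (ring x) atTop atTop
  wf : WellFounded (Precedes ring)

lemma neighborSum_eq (η : Config d) (x : Site d) :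
    neighborSum η x = ∑ p : Fin d × Bool, ((η (nb x p) : ℤˣ) : ℤ) := by
  simp [neighborSum, Fintype.sum_prod_type, nb]

lemma majorityUpdate_congr {η η' : Config d} {x : Site d} (h : ∀ p, η (nb x p) = η' (nb x p))
    (c : ℤˣ) : majorityUpdate η x c = majorityUpdate η' x c := by
  have : neighborSum η x = neighborSum η' x := by
    rw [neighborSum_eq, neighborSum_eq]
    exact Finset.sum_congr rfl fun p _ => by rw [h p]
  simp only [majorityUpdate, this]

lemma majorityUpdate_of_pos {η : Config d} {x : Site d} (h : 0 < neighborSum η x) (c : ℤˣ) :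
    majorityUpdate η x c = 1 := if_pos h

lemma majorityUpdate_one_of_nonneg {η : Config d} {x : Site d} (h : 0 ≤ neighborSum η x) :
    majorityUpdate η x 1 = 1 := by
  simp [majorityUpdate, not_lt.2 h]

/-- This is where threshold `d` enters: half of the `2 d` neighbors give at worst a tie, which a
plus coin resolves. -/
lemma neighborSum_nonneg {η : Config d} {x : Site d} (h : d ≤ nbCount {y | η y = 1} x) :
    0 ≤ neighborSum η x := by
  classical
  have h1 : ∀ p : Fin d × Bool, ((η (nb x p) : ℤˣ) : ℤ) = 2 * (if η (nb x p) = 1 then 1 else 0) - 1 := by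
    intro p
    rcases Int.units_eq_one_or (η (nb x p)) with h | h <;> simp [h]
  rw [neighborSum_eq, Finset.sum_congr rfl fun p _ => h1 p, Finset.sum_sub_distrib,
    ← Finset.mul_sum, Finset.sum_boole]
  have h2 : nbCount {y | η y = 1} x = (Finset.univ.filter fun p => η (nb x p) = 1).card := by
    rw [nbCount, ← Set.ncard_coe_finset]
    simp
  rw [h2] at h
  simp only [Finset.sum_const, Finset.card_univ, Fintype.card_prod, Fintype.card_fin,
    Fintype.card_bool, nsmul_eq_mul, mul_one]
  push_cast
  omega

open Classical in
/-- The configuration seen when each site has rung a given number of times, for the values `u x k`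
taken at the rings. -/
noncomputable def valueAfter (kind : Site d → VertexKind) (σ₀ : Config d)
    (u : Site d → ℕ → ℤˣ) (x : Site d) : ℕ → ℤˣ
  | 0 => startSpin (kind x) (σ₀ x)
  | j + 1 => if kind x = .unfrozen then u x j else startSpin (kind x) (σ₀ x)

lemma valueAfter_of_ne {u : Site d → ℕ → ℤˣ} {x : Site d} (h : kind x ≠ .unfrozen) (n : ℕ) :
    valueAfter kind σ₀ u x n = startSpin (kind x) (σ₀ x) := by
  cases n <;> simp [valueAfter, h]

/-- The values at the rings are determined by recursion. -/
lemma RegularClocks.exists_values (hr : RegularClocks ring) (kind : Site d → VertexKind)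
    (coin : Site d → ℕ → ℤˣ) (σ₀ : Config d) :
    ∃ u : Site d → ℕ → ℤˣ, ∀ x k, u x k = majorityUpdate
      (fun y => valueAfter kind σ₀ u y (numLT (ring y) (ring x k))) x (coin x k) := by
  classical
  let step : ∀ p : Site d × ℕ, (∀ q, Precedes ring q p → ℤˣ) → ℤˣ := fun p rec =>
    majorityUpdate (fun y => valueAfter kind σ₀
      -- The default `1` is never used: the update looks only at neighbors, at their rings before
      -- `p`.
      (fun z j => if h : Precedes ring (z, j) p then rec (z, j) h else 1) y
      (numLT (ring y) (ring p.1 p.2))) p.1 (coin p.1 p.2)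
  refine ⟨fun x k => hr.wf.fix step (x, k), fun x k => ?_⟩
  change hr.wf.fix step (x, k) = _
  rw [hr.wf.fix_eq]
  refine majorityUpdate_congr (fun b => ?_) _
  rcases hn : numLT (ring (nb x b)) (ring x k) with _ | j
  · rfl
  · have hj : ring (nb x b) j < ring x k :=
      (lt_numLT_iff (hr.strictMono _) (hr.tendsto _)).1 (by omega)
    have : Precedes ring (nb x b, j) (x, k) := ⟨⟨b, rfl⟩, hj⟩
    simp only [valueAfter, this, dif_pos]

lemma RegularClocks.exists_isTrajectory (hr : RegularClocks ring) (kind : Site d → VertexKind)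
    (coin : Site d → ℕ → ℤˣ) (σ₀ : Config d) : ∃ σ, IsTrajectory kind ring coin σ₀ σ := by
  obtain ⟨u, hu⟩ := hr.exists_values kind coin σ₀
  have h0 : ∀ x, numLE (ring x) 0 = 0 := fun x =>
    numLE_eq_of_forall_iff (hr.strictMono x) (hr.tendsto x) fun j => by
      have := (hr.pos x).trans_le ((hr.strictMono x).monotone (Nat.zero_le j))
      simp [this.ne']
  refine ⟨fun t x => valueAfter kind σ₀ u x (numLE (ring x) t), ?_, ?_, ?_, ?_⟩
  · intro x
    simp only [h0]
    rfl
  · intro x hx t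
    simp only [valueAfter_of_ne hx]
  · intro x s t hst h
    have : numLE (ring x) t = numLE (ring x) s := by
      refine numLE_eq_of_forall_iff (hr.strictMono x) (hr.tendsto x) fun j => ?_
      rw [lt_numLE_iff (hr.strictMono x) (hr.tendsto x)]
      refine ⟨fun hj => hj.trans hst, fun hj => ?_⟩
      by_contra! hc
      exact h j ⟨hc, hj⟩
    simp only [this]
  · intro x hx k
    have hk : numLE (ring x) (ring x k) = k + 1 :=
      numLE_eq_of_forall_iff (hr.strictMono x) (hr.tendsto x) fun j => by
        rw [(hr.strictMono x).le_iff_le]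
        omega
    have hev : ∀ᶠ s in 𝓝[<] (ring x k), ∀ p : Fin d × Bool,
        numLE (ring (nb x p)) s = numLT (ring (nb x p)) (ring x k) :=
      eventually_all.2 fun p => eventually_numLE_eq (hr.strictMono _) (hr.tendsto _) _
    filter_upwards [hev] with s hs
    simp only [hk]
    rw [valueAfter, if_pos hx, hu]
    exact majorityUpdate_congr (fun p => by rw [hs p]) _

lemma RegularClocks.pos' (hr : RegularClocks ring) (x : Site d) (k : ℕ) : 0 < ring x k :=
  (hr.pos x).trans_le ((hr.strictMono x).monotone (Nat.zero_le k))

lemma RegularClocks.neBot (hr : RegularClocks ring) (x : Site d) (k : ℕ) :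
    (𝓝[<] (ring x k)).NeBot := nhdsLT_neBot_of_exists_lt ⟨0, hr.pos' x k⟩

variable {σ σ' : ℝ≥0 → Config d}

/-- The spin at time `t` is the one set at this last ring, which reduces statements about all times
to ring times. -/
lemma RegularClocks.exists_last_ring (hr : RegularClocks ring) {x : Site d} {b t : ℝ≥0} {k₀ : ℕ}
    (hk₀ : ring x k₀ ∈ Set.Ioc b t) :
    ∃ k, k₀ ≤ k ∧ ring x k ∈ Set.Ioc b t ∧ ∀ k', ring x k' ∉ Set.Ioc (ring x k) t := by
  have hlt := (lt_numLE_iff (hr.strictMono x) (hr.tendsto x)).2 hk₀.2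
  obtain ⟨k, hk⟩ : ∃ k, numLE (ring x) t = k + 1 := Nat.exists_eq_succ_of_ne_zero (by omega)
  refine ⟨k, by omega, ⟨hk₀.1.trans_le ((hr.strictMono x).monotone (by omega)), ?_⟩, ?_⟩
  · exact (lt_numLE_iff (hr.strictMono x) (hr.tendsto x)).1 (by omega)
  · intro k' hmem
    have h1 := (lt_numLE_iff (hr.strictMono x) (hr.tendsto x)).2 hmem.2
    have h2 := (hr.strictMono x).lt_iff_lt.1 hmem.1
    omega

/-- Well-founded induction on `Precedes`: agreement at earlier rings of the neighbors gives
agreement just before the ring considered. -/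
lemma RegularClocks.trajectory_unique (hr : RegularClocks ring)
    (h : IsTrajectory kind ring coin σ₀ σ) (h' : IsTrajectory kind ring coin σ₀ σ') : σ = σ' := by
  have key : ∀ t x, (∀ k, ring x k ≤ t → σ (ring x k) x = σ' (ring x k) x) → σ t x = σ' t x := by
    intro t x hk
    by_cases hc : ∃ k₀, ring x k₀ ∈ Set.Ioc 0 t
    · obtain ⟨k₀, hk₀⟩ := hc
      obtain ⟨k, -, hkt, hlast⟩ := hr.exists_last_ring hk₀
      rw [h.constant x _ t hkt.2 hlast, h'.constant x _ t hkt.2 hlast, hk k hkt.2]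
    · push Not at hc
      rw [h.constant x 0 t zero_le hc, h'.constant x 0 t zero_le hc, h.initial, h'.initial]
  have main : ∀ p : Site d × ℕ, σ (ring p.1 p.2) p.1 = σ' (ring p.1 p.2) p.1 := by
    intro p
    induction p using hr.wf.induction with
    | _ p ih =>
      obtain ⟨x, k⟩ := p
      by_cases hx : kind x = .unfrozen
      · have := hr.neBot x k
        obtain ⟨s, ⟨h1, h2⟩, hs⟩ :=
          (((h.update x hx k).and (h'.update x hx k)).and self_mem_nhdsWithin).exists
        simp only
        rw [h1, h2]
        refine majorityUpdate_congr (fun b => key s _ fun j hj => ?_) _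
        exact ih (nb x b, j) ⟨⟨b, rfl⟩, hj.trans_lt hs⟩
      · simp only
        rw [h.frozen x hx, h'.frozen x hx, h.initial, h'.initial]
  funext t x
  exact key t x fun k _ => main (x, k)

/-- If every unfrozen site of `B` has a strict majority of its neighbors in `B`, then `B` stays
plus once it is plus. -/
lemma IsTrajectory.stays_plus (h : IsTrajectory kind ring coin σ₀ σ) (hr : RegularClocks ring)
    {B : Set (Site d)} (hB : ∀ x ∈ B, kind x = .unfrozen → ∀ η : Config d, (∀ y ∈ B, η y = 1) →
      0 < neighborSum η x) {b : ℝ≥0} (hb : ∀ x ∈ B, σ b x = 1) :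
    ∀ x ∈ B, ∀ t, b ≤ t → σ t x = 1 := by
  classical
  have key : ∀ x ∈ B, ∀ t, b ≤ t →
      (∀ k, ring x k ∈ Set.Ioc b t → σ (ring x k) x = 1) → σ t x = 1 := by
    intro x hx t hbt hk
    by_cases hc : ∃ k₀, ring x k₀ ∈ Set.Ioc b t
    · obtain ⟨k₀, hk₀⟩ := hc
      obtain ⟨k, -, hkt, hlast⟩ := hr.exists_last_ring hk₀
      rw [h.constant x _ t hkt.2 hlast, hk k hkt]
    · push Not at hc
      rw [h.constant x b t hbt hc, hb x hx]
  have main : ∀ p : Site d × ℕ, p.1 ∈ B → b < ring p.1 p.2 → σ (ring p.1 p.2) p.1 = 1 := by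
    intro p
    induction p using hr.wf.induction with
    | _ p ih =>
      obtain ⟨x, k⟩ := p
      intro hxB hbk
      by_cases hx : kind x = .unfrozen
      · have := hr.neBot x k
        have hev : ∀ᶠ s in 𝓝[<] (ring x k), b < s :=
          eventually_nhdsWithin_of_eventually_nhds (lt_mem_nhds hbk)
        obtain ⟨s, ⟨h1, h2⟩, hs⟩ := (((h.update x hx k).and hev).and self_mem_nhdsWithin).exists
        simp only
        -- `hB` needs plus on all of `B`, while the induction controls only the neighbors of `x`;
        -- the modified configuration agrees with `σ s` there.
        rw [h1, majorityUpdate_congr (η' := fun y => if y ∈ B then 1 else σ s y)]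
        · exact majorityUpdate_of_pos (hB x hxB hx _ fun y hy => if_pos hy) _
        · intro q
          by_cases hq : nb x q ∈ B
          · simp only [hq, if_true]
            exact key _ hq s h2.le fun j hj => ih (nb x q, j) ⟨⟨q, rfl⟩, hj.2.trans_lt hs⟩ hq hj.1
          · simp only [hq, if_false]
      · simp only
        rw [h.frozen x hx, ← h.frozen x hx b, hb x hxB]
  exact fun x hx t hbt => key x hx t hbt fun k hk => main (x, k) hx hk.1

/-- On each axis at least one of the two neighbors is in the box, contributing at least `0`; on an
axis where `x` is not extremal both are, contributing `2`. -/
lemma neighborSum_pos_of_box {n : ℕ} {x : Site d} (hx : x ∈ box d n) (hxc : x ∉ corners d n)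
    {η : Config d} (hη : ∀ y ∈ box d n, η y = 1) : 0 < neighborSum η x := by
  rw [mem_box] at hx
  have hplus : ∀ i, x i < n → η (x + Pi.single i 1) = 1 := by
    intro i hi
    refine hη _ (mem_box.2 fun j => ?_)
    have := hx j
    by_cases hj : j = i
    · subst hj
      simp; omega
    · simpa [hj] using this
  have hminus : ∀ i, -(n : ℤ) < x i → η (x - Pi.single i 1) = 1 := by
    intro i hi
    refine hη _ (mem_box.2 fun j => ?_)
    have := hx j
    by_cases hj : j = i
    · subst hj
      simp; omega
    · simpa [hj] using this
  have hge : ∀ u : ℤˣ, -1 ≤ (u : ℤ) := fun u => by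
    rcases Int.units_eq_one_or u with h | h <;> simp [h]
  rw [mem_corners] at hxc
  push Not at hxc
  obtain ⟨i, hi⟩ := hxc
  have hn : 0 < n := by have := hx i; omega
  refine Finset.sum_pos' (fun j _ => ?_) ⟨i, Finset.mem_univ i, ?_⟩
  · rcases lt_or_ge (x j) n with h | h
    · rw [hplus j h]
      have := hge (η (x - Pi.single j 1))
      push_cast; omega
    · rw [hminus j (by omega)]
      have := hge (η (x + Pi.single j 1))
      push_cast; omega
  · have := hx i
    rw [hplus i (by omega), hminus i (by omega)]
    norm_num

/-- During `m` consecutive unit time intervals starting at time `a`, every site of `B` rings in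
each of them, and all the coins attached to these rings are plus. -/
structure IsFillingWindow (ring : Site d → ℕ → ℝ≥0) (coin : Site d → ℕ → ℤˣ)
    (B : Set (Site d)) (a : ℝ≥0) (m : ℕ) : Prop where
  rings : ∀ x ∈ B, ∀ j < m, ∃ k, ring x k ∈ Set.Ioc (a + j) (a + j + 1)
  coins : ∀ x ∈ B, ∀ k, ring x k ∈ Set.Ioc a (a + m) → coin x k = 1

/-- A filling window of sufficient length turns a spanned set into a plus set. -/
lemma IsTrajectory.plus_of_isFillingWindow (h : IsTrajectory kind ring coin σ₀ σ)
    (hr : RegularClocks ring) (hkind : ∀ x, kind x ≠ .frozenMinus) {B : Set (Site d)}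
    (hBfin : B.Finite) (hsp : Spanned {x | kind x = .frozenPlus} d B) {a : ℝ≥0} {m : ℕ}
    (hm : B.ncard < m) (hw : IsFillingWindow ring coin B a m) : ∀ x ∈ B, σ (a + m) x = 1 := by
  have hfrozen : ∀ x, kind x = .frozenPlus → ∀ t, σ t x = 1 := by
    intro x hx t
    rw [h.frozen x (by rw [hx]; simp), h.initial, hx]
    rfl
  -- Asking for plus until the end of the window makes `C` increasing and keeps its sites available
  -- at all later updates in the window.
  set C : ℕ → Set (Site d) := fun j => {x ∈ B | ∀ t, a + j ≤ t → t ≤ a + m → σ t x = 1} with hC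
  have hCB : ∀ j, C j ⊆ B := fun j x hx => hx.1
  have hmono : ∀ j, C j ⊆ C (j + 1) := by
    refine fun j x hx => ⟨hx.1, fun t ht ht' => hx.2 t (le_trans ?_ ht) ht'⟩
    gcongr
    exact Nat.le_succ j
  have hstep : ∀ j < m, ∀ x ∈ B, d ≤ nbCount (C j ∩ B) x → x ∈ C (j + 1) := by
    intro j hj x hx hcount
    refine ⟨hx, fun t ht htm => ?_⟩
    rcases hkx : kind x with _ | _ | _
    · exact hfrozen x hkx t
    · exact absurd hkx (hkind x)
    · obtain ⟨k₀, hk₀⟩ := hw.rings x hx j hj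
      push_cast at ht
      rw [← add_assoc] at ht
      obtain ⟨k, -, hkt, hlast⟩ := hr.exists_last_ring (Set.Ioc_subset_Ioc_right ht hk₀)
      rw [h.constant x _ t hkt.2 hlast]
      have := hr.neBot x k
      have hev : ∀ᶠ s in 𝓝[<] (ring x k), a + j < s :=
        eventually_nhdsWithin_of_eventually_nhds (lt_mem_nhds hkt.1)
      obtain ⟨s, ⟨h1, h2⟩, hs⟩ := (((h.update x hkx k).and hev).and self_mem_nhdsWithin).exists
      rw [h1, hw.coins x hx k ⟨lt_of_le_of_lt (by simp) hkt.1, hkt.2.trans htm⟩]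
      refine majorityUpdate_one_of_nonneg (neighborSum_nonneg (hcount.trans (nbCount_mono ?_ x)))
      exact fun y hy => hy.1.2 s h2.le ((le_of_lt hs).trans (hkt.2.trans htm))
  -- More than `B.ncard` steps cannot all be strict; where the sequence stalls, `hstep` says that `C
  -- j` is closed.
  obtain ⟨j, hj, hjC⟩ : ∃ j < m, C j = C (j + 1) := by
    by_contra! hne
    have hcard : ∀ j ≤ m, j ≤ (C j).ncard := by
      intro j
      induction j with
      | zero => simp
      | succ j ih =>
        intro hj
        have := Set.ncard_lt_ncard ((hmono j).ssubset_of_ne (hne j (by omega)))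
          (hBfin.subset (hCB _))
        have := ih (by omega)
        omega
    have := hcard m le_rfl
    have := Set.ncard_le_ncard (hCB m) hBfin
    omega
  have hBC : B ⊆ C j := hsp (C j) ⟨fun x hx => ⟨hx.2, fun t _ _ => hfrozen x hx.1 t⟩,
    fun x hx hcount => hjC ▸ hstep j hj x hx hcount⟩
  exact fun x hx => (hBC hx).2 _ (by gcongr) le_rfl

/-- The deterministic part of the fixation theorem. -/
theorem IsTrajectory.fixatesToPlus (h : IsTrajectory kind ring coin σ₀ σ)
    (hr : RegularClocks ring) (hkind : ∀ x, kind x ≠ .frozenMinus)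
    (hbox : ∀ N, ∃ n ≥ N, Spanned {x | kind x = .frozenPlus} d (box d n) ∧
      ∀ x ∈ corners d n, kind x = .frozenPlus)
    (hwin : ∀ n m, ∃ a, IsFillingWindow ring coin (box d n) a m) : FixatesToPlus σ := by
  intro x
  obtain ⟨n, hn, hsp, hcor⟩ := hbox (∑ i, (x i).natAbs)
  have hx : x ∈ box d n := mem_box.2 fun i => by
    have := Finset.single_le_sum (f := fun i => (x i).natAbs) (fun _ _ => Nat.zero_le _)
      (Finset.mem_univ i)
    omega
  obtain ⟨a, ha⟩ := hwin n ((box d n).ncard + 1)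
  have hplus := h.plus_of_isFillingWindow hr hkind (finite_cube _ _ _) hsp (Nat.lt_succ_self _) ha
  refine ⟨_, h.stays_plus hr (fun y hy hyk η hη => ?_) hplus x hx⟩
  refine neighborSum_pos_of_box hy (fun hyc => ?_) hη
  rw [hcor y hyc] at hyk
  cases hyk

end Dynamics

/-! ### Poisson clocks -/

section Clock

variable {Ω : Type*} [MeasurableSpace Ω] {P : Measure Ω}

lemma setOf_le_eq_Iio {τ : ℕ → ℝ≥0} (hm : StrictMono τ) (ht : Tendsto τ atTop atTop) (t : ℝ≥0) :
    {k | τ k ≤ t} = (Finset.range (numLE τ t) : Set ℕ) := by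
  ext k
  simp [lt_numLE_iff hm ht]

lemma ringCount_eq_numLE {τ : ℕ → ℝ≥0} (hm : StrictMono τ) (ht : Tendsto τ atTop atTop)
    (t : ℝ≥0) : ringCount τ t = numLE τ t := by
  rw [ringCount, setOf_le_eq_Iio hm ht, Set.ncard_coe_finset, Finset.card_range]

lemma exists_ring_iff {τ : ℕ → ℝ≥0} (hm : StrictMono τ) (ht : Tendsto τ atTop atTop)
    {a b : ℝ≥0} : (∃ k, τ k ∈ Set.Ioc a b) ↔ ringCount τ b - ringCount τ a ≠ 0 := by
  rw [ringCount_eq_numLE hm ht, ringCount_eq_numLE hm ht]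
  constructor
  · rintro ⟨k, h1, h2⟩
    have h3 := (lt_numLE_iff hm ht).2 h2
    have h4 := (lt_numLE_iff hm ht (j := k)).not.2 (not_le.2 h1)
    omega
  · intro h
    refine ⟨numLE τ a, ?_, (lt_numLE_iff hm ht).1 (by omega)⟩
    have := (lt_numLE_iff hm ht (t := a) (j := numLE τ a)).not
    simpa using this

lemma measurable_ringCount (t : ℝ≥0) : Measurable fun τ : ℕ → ℝ≥0 => ringCount τ t := by
  -- A positive `ncard` comes from a finite set, of which there are countably many; the value `0`
  -- also covers infinite sets and is treated as the complement.
  have hs : ∀ n, MeasurableSet ((fun τ : ℕ → ℝ≥0 => ringCount τ t) ⁻¹' {n + 1}) := by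
    intro n
    have h : (fun τ : ℕ → ℝ≥0 => ringCount τ t) ⁻¹' {n + 1} =
        ⋃ s ∈ {s : Finset ℕ | s.card = n + 1}, {τ | ∀ k, k ∈ s ↔ τ k ≤ t} := by
      ext τ
      simp only [Set.mem_preimage, Set.mem_singleton_iff, Set.mem_iUnion, Set.mem_ofPred_eq,
        exists_prop, ringCount]
      constructor
      · intro h
        have hfin : {k | τ k ≤ t}.Finite := Set.finite_of_ncard_ne_zero (by omega)
        refine ⟨hfin.toFinset, ?_, fun k => by simp⟩
        rw [← Set.ncard_eq_toFinset_card _ hfin, h]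
      · rintro ⟨s, hs, h⟩
        rw [← hs, ← Set.ncard_coe_finset]
        congr 1
        ext k
        exact (h k).symm
    rw [h]
    refine MeasurableSet.biUnion (Set.to_countable _) fun s _ => ?_
    refine measurableSet_setOfPred.2 (Measurable.forall fun k => ?_)
    exact measurable_const.iff (measurableSet_setOfPred.1 (measurableSet_le (by fun_prop) (by fun_prop)))
  refine measurable_to_countable' fun n => ?_
  rcases n with _ | n
  · have h : (fun τ : ℕ → ℝ≥0 => ringCount τ t) ⁻¹' {0} =
        (⋃ n, (fun τ : ℕ → ℝ≥0 => ringCount τ t) ⁻¹' {n + 1})ᶜ := by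
      ext τ
      simp only [Set.mem_preimage, Set.mem_singleton_iff, Set.mem_compl_iff, Set.mem_iUnion,
        not_exists]
      constructor
      · intro h n
        omega
      · intro h
        by_contra hc
        exact h (ringCount τ t - 1) (by omega)
    rw [h]
    exact (MeasurableSet.iUnion hs).compl
  · exact hs n

lemma measurableSet_exists_ring (a b : ℝ≥0) :
    MeasurableSet {τ : ℕ → ℝ≥0 | ∃ k, τ k ∈ Set.Ioc a b} := by
  have : {τ : ℕ → ℝ≥0 | ∃ k, τ k ∈ Set.Ioc a b} = ⋃ k, (fun τ => τ k) ⁻¹' Set.Ioc a b := by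
    ext τ
    simp
  rw [this]
  exact MeasurableSet.iUnion fun k => measurableSet_Ioc.preimage (measurable_pi_apply k)

variable {τ : ℕ → Ω → ℝ≥0}

lemma IsPoissonClock.measureReal_count_eq (h : IsPoissonClock P τ) {a b : ℝ≥0} (hab : a ≤ b)
    (n : ℕ) : P.real {ω | ringCount (fun k => τ k ω) b - ringCount (fun k => τ k ω) a = n} =
      Real.exp (-((b - a : ℝ≥0) : ℝ)) * ((b - a : ℝ≥0) : ℝ) ^ n / n.factorial := by
  have hl := h.law a b hab
  rw [← poissonMeasure_real_singleton, ← hl.map_eq, measureReal_def, measureReal_def,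
    Measure.map_apply_of_aemeasurable hl.aemeasurable (measurableSet_singleton n)]
  rfl

/-- The probability of at least one ring is `1 - exp (-(b - a))`. -/
lemma IsPoissonClock.measureReal_exists_ring_le [IsProbabilityMeasure P] (h : IsPoissonClock P τ)
    {a b : ℝ≥0} (hab : a ≤ b) :
    P.real {ω | ∃ k, τ k ω ∈ Set.Ioc a b} ≤ (b - a : ℝ≥0) := by
  have hm : Measurable fun ω => fun k => τ k ω := measurable_pi_lambda _ h.measurable
  set N : Ω → ℕ := fun ω => ringCount (fun k => τ k ω) b - ringCount (fun k => τ k ω) a with hN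
  have hNm : MeasurableSet {ω | N ω = 0} :=
    (((measurable_ringCount b).comp hm).sub ((measurable_ringCount a).comp hm))
      (measurableSet_singleton 0)
  have h1 : P.real {ω | ∃ k, τ k ω ∈ Set.Ioc a b} ≤ P.real {ω | N ω = 0}ᶜ := by
    refine ENNReal.toReal_mono (measure_ne_top _ _) (measure_mono_ae ?_)
    filter_upwards [h.strictMono, h.tendsto] with ω h2 h3 h4
    exact (exists_ring_iff h2 h3).1 h4
  have h2 := h.measureReal_count_eq hab 0
  rw [probReal_compl_eq_one_sub hNm] at h1
  change P.real {ω | N ω = 0} = _ at h2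
  simp only [pow_zero, mul_one, Nat.factorial_zero, Nat.cast_one, div_one] at h2
  have := Real.add_one_le_exp (-((b - a : ℝ≥0) : ℝ))
  linarith

end Clock

/-! ### Lattice paths -/

section Paths

variable {d : ℕ}

/-- The sites visited by the path from `x` with the given steps. -/
def pathSites (x : Site d) : List (Fin d × Bool) → List (Site d)
  | [] => [x]
  | b :: l => x :: pathSites (nb x b) l

lemma length_pathSites (x : Site d) (l : List (Fin d × Bool)) :
    (pathSites x l).length = l.length + 1 := by
  induction l generalizing x with
  | nil => rfl
  | cons b l ih => simp [pathSites, ih]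

/-- A sequence of neighboring sites that visits each site finitely often contains self-avoiding
paths of any length. -/
lemma exists_nodup_path (n : ℕ) (y : ℕ → Site d) (hy : ∀ i, ∃ b, y (i + 1) = nb (y i) b)
    (hfin : ∀ s, {i | y i = s}.Finite) :
    ∃ l : List (Fin d × Bool), l.length = n ∧ (pathSites (y 0) l).Nodup ∧
      ∀ z ∈ pathSites (y 0) l, ∃ i, y i = z := by
  induction n generalizing y with
  | zero => exact ⟨[], rfl, by simp [pathSites], fun z hz => ⟨0, by simpa [pathSites, eq_comm] using hz⟩⟩
  | succ n ih =>
    -- After the last visit `T` to `y 0` the sequence avoids that site, so the path can leave from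
    -- there.
    obtain ⟨T, hT, hmax⟩ := Set.exists_max_image {i | y i = y 0} id (hfin _) ⟨0, rfl⟩
    obtain ⟨b, hb⟩ := hy T
    obtain ⟨l, hl, hnd, hmem⟩ := ih (fun i => y (T + 1 + i)) (fun i => hy (T + 1 + i)) fun s =>
      (hfin s).preimage (f := fun i => T + 1 + i) (add_right_injective _).injOn
    rw [add_zero, hb, show y T = y 0 from hT] at hnd hmem
    refine ⟨b :: l, by simp [hl], List.nodup_cons.2 ⟨fun h => ?_, hnd⟩, fun z hz => ?_⟩
    · obtain ⟨i, hi⟩ := hmem _ h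
      have := hmax (T + 1 + i) hi
      simp only [id] at this
      omega
    · rcases List.mem_cons.1 hz with rfl | hz
      · exact ⟨0, rfl⟩
      · obtain ⟨i, hi⟩ := hmem z hz
        exact ⟨_, hi⟩

variable {Ω : Type*} [MeasurableSpace Ω] {P : Measure Ω}

/-- In subcritical site percolation there are no long self-avoiding open paths. -/
lemma ae_exists_no_path {W : Site d → Set Ω} {ε : ℝ} (hε0 : 0 ≤ ε)
    [IsProbabilityMeasure P] (hε : 2 * d * ε < 1)
    (hW : ∀ A : Finset (Site d), P.real {ω | ∀ x ∈ A, ω ∈ W x} ≤ ε ^ A.card) (x : Site d) :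
    ∀ᵐ ω ∂P, ∃ n, ∀ l : List (Fin d × Bool), l.length = n → (pathSites x l).Nodup →
      ∃ z ∈ pathSites x l, ω ∉ W z := by
  classical
  set E : ℕ → Set Ω := fun n => {ω | ∃ l : List (Fin d × Bool), l.length = n ∧
    (pathSites x l).Nodup ∧ ∀ z ∈ pathSites x l, ω ∈ W z} with hE
  -- There are `(2 d) ^ n` step sequences, and a self-avoiding one visits `n + 1` distinct sites.
  have hbound : ∀ n, P.real (E n) ≤ (2 * d * ε) ^ n * ε := by
    intro n
    have hsub : E n ⊆ ⋃ v ∈ (Finset.univ : Finset (Fin n → Fin d × Bool)),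
        {ω | (pathSites x (List.ofFn v)).Nodup ∧ ∀ z ∈ pathSites x (List.ofFn v), ω ∈ W z} := by
      rintro ω ⟨l, rfl, h1, h2⟩
      simp only [Set.mem_iUnion]
      refine ⟨l.get, Finset.mem_univ _, ?_⟩
      rw [Set.mem_ofPred_eq, List.ofFn_get]
      exact ⟨h1, h2⟩
    refine (measureReal_mono hsub (measure_ne_top _ _)).trans
      ((measureReal_biUnion_finset_le _ _).trans ?_)
    refine (Finset.sum_le_card_nsmul _ _ (ε ^ (n + 1)) fun v _ => ?_).trans_eq ?_
    · by_cases hnd : (pathSites x (List.ofFn v)).Nodup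
      · refine (measureReal_mono (s₂ := {ω | ∀ z ∈ (pathSites x (List.ofFn v)).toFinset, ω ∈ W z})
          fun ω hω z hz => hω.2 z (List.mem_toFinset.1 hz)).trans ((hW _).trans_eq ?_)
        rw [List.toFinset_card_of_nodup hnd, length_pathSites, List.length_ofFn]
      · simp only [hnd, false_and, Set.ofPred_false, measureReal_empty]
        positivity
    · simp only [Finset.card_univ, Fintype.card_pi_const, Fintype.card_prod, Fintype.card_fin,
        Fintype.card_bool, nsmul_eq_mul]
      push_cast
      ring
  have h0 : P.real (⋂ n, E n) ≤ 0 := by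
    have ht : Tendsto (fun n : ℕ => (2 * d * ε) ^ n * ε) atTop (𝓝 (0 * ε)) :=
      (tendsto_pow_atTop_nhds_zero_of_lt_one (by positivity) hε).mul_const ε
    rw [zero_mul] at ht
    exact ge_of_tendsto' ht fun n => (measureReal_mono (Set.iInter_subset _ n)).trans (hbound n)
  have h1 : P (⋂ n, E n) = 0 := by
    rw [measureReal_def, ENNReal.toReal_nonneg.ge_iff_eq', ENNReal.toReal_eq_zero_iff] at h0
    exact h0.resolve_right (measure_ne_top _ _)
  rw [ae_iff]
  refine measure_mono_null (fun ω hω => ?_) h1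
  simp only [Set.mem_ofPred_eq] at hω
  push Not at hω
  exact Set.mem_iInter.2 hω

end Paths

/-! ### Almost sure regularity of the clocks -/

section Regular

variable {d : ℕ}

/-- The clocks are regular if in each of consecutive time slabs the sites that ring form no long
self-avoiding paths. -/
lemma regularClocks_of_no_path {ring : Site d → ℕ → ℝ≥0} (hpos : ∀ x, 0 < ring x 0)
    (hmono : ∀ x, StrictMono (ring x)) (htend : ∀ x, Tendsto (ring x) atTop atTop) {δ : ℝ≥0}
    (hδ : 0 < δ) (h : ∀ (j : ℕ) (x : Site d), ∃ n, ∀ l : List (Fin d × Bool), l.length = n →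
      (pathSites x l).Nodup →
        ∃ z ∈ pathSites x l, ¬ ∃ k, ring z k ∈ Set.Ioc (j * δ) ((j + 1 : ℕ) * δ)) :
    RegularClocks ring := by
  refine ⟨hpos, hmono, htend, wellFounded_iff_isEmpty_descending_chain.2 ⟨?_⟩⟩
  rintro ⟨p, hp⟩
  set t : ℕ → ℝ≥0 := fun n => ring (p n).1 (p n).2 with ht
  have hanti : StrictAnti t := strictAnti_nat_of_succ_lt fun n => (hp n).2
  -- The slab index cannot increase along a descending chain, so from its minimum on the chain stays
  -- in one slab.
  set c : ℕ → ℕ := fun n => ⌈t n / δ⌉₊ with hc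
  obtain ⟨n₀, hn₀⟩ : ∃ n₀, ∀ n, c n₀ ≤ c n :=
    ⟨Function.argmin c, fun n => Function.argmin_le c n⟩
  have hceq : ∀ n, c (n₀ + n) = c n₀ := fun n => by
    refine le_antisymm (Nat.ceil_mono ?_) (hn₀ _)
    exact div_le_div_of_nonneg_right (hanti.antitone (Nat.le_add_right _ _)) zero_le
  have htpos : 0 < t n₀ :=
    (hpos _).trans_le ((hmono _).monotone (Nat.zero_le _))
  obtain ⟨j, hj⟩ : ∃ j, c n₀ = j + 1 :=
    Nat.exists_eq_succ_of_ne_zero (Nat.ceil_pos.2 (div_pos htpos hδ)).ne'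
  have hslab : ∀ n, t (n₀ + n) ∈ Set.Ioc (j * δ) ((j + 1 : ℕ) * δ) := by
    intro n
    have h1 := hceq n
    rw [hj, hc, Nat.ceil_eq_iff (by omega)] at h1
    simp only [Nat.add_sub_cancel] at h1
    exact ⟨(lt_div_iff₀ hδ).1 h1.1, (div_le_iff₀ hδ).1 h1.2⟩
  obtain ⟨n, hn⟩ := h j (p n₀).1
  -- Each site is visited finitely often: it has finitely many rings up to the end of the slab, and
  -- the chain uses no ring twice.
  obtain ⟨l, hl, hnd, hmem⟩ := exists_nodup_path n (fun i => (p (n₀ + i)).1)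
    (fun i => (hp (n₀ + i)).1) fun s => by
      have hfin : {k | ring s k ≤ (j + 1 : ℕ) * δ}.Finite := by
        rw [setOf_le_eq_Iio (hmono s) (htend s)]
        exact Finset.finite_toSet _
      refine Set.Finite.of_finite_image (f := fun i => (p (n₀ + i)).2) (hfin.subset ?_) ?_
      · rintro _ ⟨i, hi, rfl⟩
        have := (hslab i).2
        simp only [ht, show (p (n₀ + i)).1 = s from hi] at this
        exact this
      · intro i hi i' hi' hii'
        have hi : (p (n₀ + i)).1 = s := hi
        have hi' : (p (n₀ + i')).1 = s := hi'
        have : t (n₀ + i) = t (n₀ + i') := by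
          simp only at hii'
          simp only [ht, hi, hi', hii']
        have := hanti.injective this
        omega
  obtain ⟨z, hz, hzW⟩ := hn l hl hnd
  obtain ⟨i, rfl⟩ := hmem z hz
  exact hzW ⟨_, hslab i⟩

variable {Ω : Type*} [MeasurableSpace Ω] {P : Measure Ω}

theorem ae_regularClocks [IsProbabilityMeasure P] {ring : Site d → ℕ → Ω → ℝ≥0}
    (hclock : ∀ x, IsPoissonClock P (ring x)) (hind : iIndepFun (fun x ω k => ring x k ω) P) :
    ∀ᵐ ω ∂P, RegularClocks fun x k => ring x k ω := by
  -- A site rings in a slab with probability at most `δ`, and `2 d δ < 1` beats the number of paths.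
  set δ : ℝ≥0 := (2 * d + 1)⁻¹ with hδ
  have hδ0 : 0 < δ := by positivity
  have hδ1 : 2 * d * (δ : ℝ) < 1 := by
    rw [hδ]
    push_cast
    rw [← div_eq_mul_inv, div_lt_one (by positivity)]
    linarith
  have hpath : ∀ (j : ℕ) (x : Site d), ∀ᵐ ω ∂P, ∃ n, ∀ l : List (Fin d × Bool), l.length = n →
      (pathSites x l).Nodup → ∃ z ∈ pathSites x l,
        ω ∉ {ω | ∃ k, ring z k ω ∈ Set.Ioc (j * δ) ((j + 1 : ℕ) * δ)} := by
    refine fun j x => ae_exists_no_path (ε := δ) δ.2 hδ1 (fun A => ?_) x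
    have h1 := measureReal_forall_mem_eq hind A
      (s := fun _ => {τ : ℕ → ℝ≥0 | ∃ k, τ k ∈ Set.Ioc (j * δ) ((j + 1 : ℕ) * δ)})
      fun _ _ => measurableSet_exists_ring _ _
    refine h1.trans_le ?_
    rw [← Finset.prod_const]
    refine Finset.prod_le_prod (fun _ _ => measureReal_nonneg) fun y _ => ?_
    refine ((hclock y).measureReal_exists_ring_le (by gcongr; omega)).trans_eq ?_
    congr 1
    rw [← tsub_mul]
    simp
  filter_upwards [ae_all_iff.2 fun x => (hclock x).pos, ae_all_iff.2 fun x => (hclock x).strictMono,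
    ae_all_iff.2 fun x => (hclock x).tendsto, ae_all_iff.2 fun j => ae_all_iff.2 (hpath j)]
    with ω h1 h2 h3 h4
  exact regularClocks_of_no_path h1 h2 h3 hδ0 h4

end Regular

/-! ### Filling windows occur almost surely -/

instance : MeasurableSingletonClass ℤˣ where
  measurableSet_singleton u := by
    refine ⟨{(u : ℤ)}, measurableSet_singleton _, ?_⟩
    ext v
    simp [Units.ext_iff]

section Windows

variable {d : ℕ} {Ω : Type*} [MeasurableSpace Ω] {P : Measure Ω} {ring : Site d → ℕ → Ω → ℝ≥0}
  {coin : Site d → ℕ → Ω → ℤˣ}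

/-- Every site of `B` rings exactly once in each of `m` consecutive unit intervals after `a`. -/
def RingsOnce (r : Site d → ℕ → ℝ≥0) (B : Finset (Site d)) (a m : ℕ) : Prop :=
  ∀ x ∈ B, ∀ l ∈ Finset.Ico a (a + m), ringCount (r x) (l + 1 : ℕ) - ringCount (r x) (l : ℕ) = 1

/-- Counts over distinct sites and unit intervals are independent, each equal to `1` with
probability `exp (-1)`. Exactly one ring per interval fixes the number of coins in a window, so that
the coin estimate is uniform over windows. -/
lemma ae_frequently_ringsOnce [IsProbabilityMeasure P] (hclock : ∀ x, IsPoissonClock P (ring x))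
    (hind : iIndepFun (fun x ω k => ring x k ω) P) (B : Finset (Site d)) (m : ℕ) :
    ∀ᵐ ω ∂P, ∃ᶠ n : ℕ in atTop, RingsOnce (fun x k => ring x k ω) B (n * m) m := by
  classical
  set N : Site d → ℕ → Ω → ℕ := fun x l ω =>
    ringCount (fun k => ring x k ω) (l + 1 : ℕ) - ringCount (fun k => ring x k ω) (l : ℕ) with hN
  have hm1 : ∀ l : ℕ, Measurable fun τ : ℕ → ℝ≥0 =>
      ringCount τ (l + 1 : ℕ) - ringCount τ (l : ℕ) := fun l =>
    (measurable_ringCount _).sub (measurable_ringCount _)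
  have hNm : ∀ x l, Measurable (N x l) := fun x l =>
    (hm1 l).comp (measurable_pi_lambda _ (hclock x).measurable)
  have hNind : iIndepFun (fun (p : Site d × ℕ) ω => N p.1 p.2 ω) P := by
    refine iIndepFun_uncurry' hNm ?_ fun x => ?_
    · exact hind.comp (fun _ τ l => ringCount τ (l + 1 : ℕ) - ringCount τ (l : ℕ))
        fun _ => measurable_pi_lambda _ hm1
    · exact (hclock x).indep.nat (t := fun l : ℕ => (l : ℝ≥0)) Nat.mono_cast
  have hq : 0 < Real.exp (-1) ^ (B.card * m) := pow_pos (Real.exp_pos _) _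
  refine ae_frequently_mem (Z := fun (p : Site d × ℕ) ω => N p.1 p.2 ω)
    (A := fun n => B ×ˢ Finset.Ico (n * m) (n * m + m))
    (E := fun n => {ω | RingsOnce (fun x k => ring x k ω) B (n * m) m})
    (fun p => hNm p.1 p.2) hNind ?_ ?_ hq ?_
  · intro i j hij
    refine Finset.disjoint_left.2 fun p hp hp' => ?_
    have h1 := Finset.mem_Ico.1 (Finset.mem_product.1 hp).2
    have h2 := Finset.mem_Ico.1 (Finset.mem_product.1 hp').2
    rcases lt_or_gt_of_ne hij with h | h
    · have : (i + 1) * m ≤ j * m := Nat.mul_le_mul_right _ h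
      linarith
    · have : (j + 1) * m ≤ i * m := Nat.mul_le_mul_right _ h
      linarith
  · intro n
    refine measurableSet_sigmaOn fun ω ω' h h1 x hx l hl => ?_
    exact (h (x, l) (Finset.mem_product.2 ⟨hx, hl⟩)).symm.trans (h1 x hx l hl)
  · intro n
    have h1 := measureReal_forall_mem_eq hNind (B ×ˢ Finset.Ico (n * m) (n * m + m))
      (s := fun _ => {1}) fun _ _ => measurableSet_singleton _
    have h2 : ∀ p : Site d × ℕ, P.real {ω | N p.1 p.2 ω ∈ ({1} : Set ℕ)} = Real.exp (-1) := by
      intro p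
      refine ((hclock p.1).measureReal_count_eq (a := (p.2 : ℕ)) (b := (p.2 + 1 : ℕ))
        (by gcongr; omega) 1).trans ?_
      simp
    simp only [h2, Finset.prod_const, Finset.card_product, Nat.card_Ico,
      Nat.add_sub_cancel_left] at h1
    rw [← h1]
    refine measureReal_mono fun ω hω x hx l hl => ?_
    exact hω (x, l) (Finset.mem_product.2 ⟨hx, hl⟩)

/-- For fixed clocks with infinitely many suitable windows, the coins almost surely make one of
these windows filling. -/
lemma ae_exists_isFillingWindow_of_ringsOnce [IsProbabilityMeasure P]
    (hcm : ∀ x k, Measurable (coin x k)) (hfair : ∀ x k, P.real {ω | coin x k ω = 1} = 1 / 2)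
    (hind : iIndepFun (fun (p : Site d × ℕ) ω => coin p.1 p.2 ω) P)
    {r : Site d → ℕ → ℝ≥0} (hmono : ∀ x, StrictMono (r x))
    (htend : ∀ x, Tendsto (r x) atTop atTop) (B : Finset (Site d)) (m : ℕ)
    (hfreq : ∃ᶠ n : ℕ in atTop, RingsOnce r B (n * m) m) :
    ∀ᵐ ω ∂P, ∃ n : ℕ, IsFillingWindow r (fun x k => coin x k ω) B ((n * m : ℕ) : ℝ≥0) m := by
  classical
  obtain ⟨φ, hφ, hφr⟩ := extraction_of_frequently_atTop hfreq
  -- Indices of the rings of `x` in the `i`-th good window. They are deterministic as the clocks are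
  -- fixed, and disjoint windows use disjoint sets of coins.
  set T : ℕ → Site d → Finset ℕ := fun i x =>
    Finset.Ico (numLE (r x) (φ i * m : ℕ)) (numLE (r x) (φ i * m + m : ℕ)) with hT
  have hmemT : ∀ i x k, k ∈ T i x ↔ r x k ∈ Set.Ioc ((φ i * m : ℕ) : ℝ≥0) (φ i * m + m : ℕ) := by
    intro i x k
    rw [hT, Finset.mem_Ico, lt_numLE_iff (hmono x) (htend x), ← not_lt,
      lt_numLE_iff (hmono x) (htend x), not_le]
    rfl
  have hcard : ∀ i, ∀ x ∈ B, (T i x).card = m := by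
    intro i x hx
    have h : ∀ j ≤ m, numLE (r x) (φ i * m + j : ℕ) = numLE (r x) (φ i * m : ℕ) + j := by
      intro j
      induction j with
      | zero => simp
      | succ j ih =>
        intro hj
        have h1 := hφr i x hx (φ i * m + j) (Finset.mem_Ico.2 ⟨by omega, by omega⟩)
        rw [ringCount_eq_numLE (hmono x) (htend x), ringCount_eq_numLE (hmono x) (htend x),
          ih (by omega)] at h1
        rw [← add_assoc]
        omega
    rw [hT, Nat.card_Ico, h m le_rfl, Nat.add_sub_cancel_left]
  set A : ℕ → Finset (Site d × ℕ) := fun i => B.biUnion fun x => (T i x).image fun k => (x, k)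
    with hA
  have hmemA : ∀ i p, p ∈ A i ↔ p.1 ∈ B ∧ p.2 ∈ T i p.1 := by
    rintro i ⟨x, k⟩
    simp only [hA, Finset.mem_biUnion, Finset.mem_image, Prod.mk.injEq]
    constructor
    · rintro ⟨_, hx, _, hk, rfl, rfl⟩
      exact ⟨hx, hk⟩
    · rintro ⟨hx, hk⟩
      exact ⟨x, hx, k, hk, rfl, rfl⟩
  have hmain := ae_exists_mem (fun p : Site d × ℕ => hcm p.1 p.2) hind (A := A)
    (E := fun i => {ω | ∀ p ∈ A i, coin p.1 p.2 ω = 1}) (fun i j hij => ?_) (fun i => ?_)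
    (q := (1 / 2) ^ (B.card * m)) (by positivity) (fun i => ?_)
  · filter_upwards [hmain] with ω hω
    obtain ⟨i, hi⟩ := hω
    refine ⟨φ i, ⟨fun x hx j hj => ?_, fun x hx k hk => ?_⟩⟩
    · have h1 := hφr i x hx (φ i * m + j) (Finset.mem_Ico.2 ⟨by omega, by omega⟩)
      have := (exists_ring_iff (hmono x) (htend x)).2 (by rw [h1]; exact one_ne_zero)
      push_cast at this ⊢
      exact this
    · refine hi (x, k) ((hmemA i _).2 ⟨hx, (hmemT i x k).2 ?_⟩)
      push_cast at hk ⊢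
      exact hk
  · refine Finset.disjoint_left.2 fun p hp hp' => ?_
    have h1 := (hmemT i _ _).1 ((hmemA i p).1 hp).2
    have h2 := (hmemT j _ _).1 ((hmemA j p).1 hp').2
    have h3 : φ i * m < φ j * m + m := by exact_mod_cast h1.1.trans_le h2.2
    have h4 : φ j * m < φ i * m + m := by exact_mod_cast h2.1.trans_le h1.2
    rcases lt_or_gt_of_ne hij with h | h
    · have : (φ i + 1) * m ≤ φ j * m := Nat.mul_le_mul_right _ (hφ h)
      linarith
    · have : (φ j + 1) * m ≤ φ i * m := Nat.mul_le_mul_right _ (hφ h)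
      linarith
  · exact measurableSet_sigmaOn fun ω ω' h h1 p hp => (h p hp).symm.trans (h1 p hp)
  · have h1 := measureReal_forall_mem_eq hind (A i) (s := fun _ => {1})
      fun _ _ => measurableSet_singleton _
    simp only [Set.mem_singleton_iff, hfair, Finset.prod_const] at h1
    rw [h1]
    refine pow_le_pow_of_le_one (by norm_num) (by norm_num) ?_
    refine Finset.card_biUnion_le.trans ((Finset.sum_le_card_nsmul _ _ m fun x hx => ?_).trans_eq ?_)
    · exact Finset.card_image_le.trans (hcard i x hx).le
    · rw [smul_eq_mul]

lemma measurableSet_isFillingWindow (B : Set (Site d)) (a : ℝ≥0) (m : ℕ) :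
    MeasurableSet {p : (Site d → ℕ → ℝ≥0) × (Site d → ℕ → ℤˣ) | IsFillingWindow p.1 p.2 B a m} := by
  have hr : ∀ (x : Site d) (k : ℕ) (b c : ℝ≥0), Measurable
      fun p : (Site d → ℕ → ℝ≥0) × (Site d → ℕ → ℤˣ) => p.1 x k ∈ Set.Ioc b c := fun x k b c =>
    measurableSet_setOfPred.1 (measurableSet_Ioc.preimage (by fun_prop))
  have hc : ∀ (x : Site d) (k : ℕ), Measurable
      fun p : (Site d → ℕ → ℝ≥0) × (Site d → ℕ → ℤˣ) => p.2 x k = 1 := fun x k =>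
    measurableSet_setOfPred.1 ((measurableSet_singleton (1 : ℤˣ)).preimage
      (f := fun p : (Site d → ℕ → ℝ≥0) × (Site d → ℕ → ℤˣ) => p.2 x k) (by fun_prop))
  have h : {p : (Site d → ℕ → ℝ≥0) × (Site d → ℕ → ℤˣ) | IsFillingWindow p.1 p.2 B a m} =
      {p | (∀ x, x ∈ B → ∀ j, j < m → ∃ k, p.1 x k ∈ Set.Ioc (a + j) (a + j + 1)) ∧
        ∀ x, x ∈ B → ∀ k, p.1 x k ∈ Set.Ioc a (a + m) → p.2 x k = 1} :=
    Set.ext fun p => ⟨fun h => ⟨h.1, h.2⟩, fun h => ⟨h.1, h.2⟩⟩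
  rw [h]
  refine measurableSet_setOfPred.2 (Measurable.and ?_ ?_)
  · exact Measurable.forall fun x => measurable_const.imp (Measurable.forall fun j =>
      measurable_const.imp (Measurable.exists fun k => hr _ _ _ _))
  · exact Measurable.forall fun x => measurable_const.imp (Measurable.forall fun k =>
      (hr _ _ _ _).imp (hc _ _))

theorem ae_exists_isFillingWindow [IsProbabilityMeasure P]
    (hclock : ∀ x, IsPoissonClock P (ring x)) (hind : iIndepFun (fun x ω k => ring x k ω) P)
    (hcm : ∀ x k, Measurable (coin x k)) (hfair : ∀ x k, P.real {ω | coin x k ω = 1} = 1 / 2)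
    (hcind : iIndepFun (fun (p : Site d × ℕ) ω => coin p.1 p.2 ω) P)
    (hindep : IndepFun (fun ω x k => ring x k ω) (fun ω x k => coin x k ω) P)
    (B : Finset (Site d)) (m : ℕ) :
    ∀ᵐ ω ∂P, ∃ a, IsFillingWindow (fun x k => ring x k ω) (fun x k => coin x k ω) B a m := by
  have hrM : Measurable fun ω x k => ring x k ω :=
    measurable_pi_lambda _ fun x => measurable_pi_lambda _ fun k => (hclock x).measurable k
  have hcM : Measurable fun ω x k => coin x k ω :=
    measurable_pi_lambda _ fun x => measurable_pi_lambda _ fun k => hcm x k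
  have hset : MeasurableSet {p : (Site d → ℕ → ℝ≥0) × (Site d → ℕ → ℤˣ) |
      ∃ n : ℕ, IsFillingWindow p.1 p.2 B ((n * m : ℕ) : ℝ≥0) m} := by
    rw [Set.ofPred_exists]
    exact MeasurableSet.iUnion fun n => measurableSet_isFillingWindow _ _ _
  have hlaw := (indepFun_iff_map_prod_eq_prod_map_map hrM.aemeasurable hcM.aemeasurable).1 hindep
  have := Measure.isProbabilityMeasure_map (μ := P) hcM.aemeasurable
  -- By independence the joint law is a product, so by Fubini the clocks may be frozen while the
  -- coins are drawn.
  have hae : ∀ᵐ r ∂P.map (fun ω x k => ring x k ω), ∀ᵐ c ∂P.map (fun ω x k => coin x k ω),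
      ∃ n : ℕ, IsFillingWindow r c B ((n * m : ℕ) : ℝ≥0) m := by
    refine (ae_map_iff hrM.aemeasurable
      (measurable_measure_prodMk_left hset.compl (measurableSet_singleton 0))).2 ?_
    filter_upwards [ae_frequently_ringsOnce hclock hind B m,
      ae_all_iff.2 fun x => (hclock x).strictMono, ae_all_iff.2 fun x => (hclock x).tendsto]
      with ω h1 h2 h3
    refine (ae_map_iff hcM.aemeasurable (measurable_prodMk_left hset)).2 ?_
    exact ae_exists_isFillingWindow_of_ringsOnce hcm hfair hcind h2 h3 B m h1
  have hprod := (Measure.ae_prod_iff_ae_ae hset).2 hae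
  rw [← hlaw] at hprod
  filter_upwards [ae_of_ae_map (hrM.prodMk hcM).aemeasurable hprod] with ω hω
  exact ⟨_, hω.choose_spec⟩

end Windows

end FrozenMajority

/-! ### Assembly of the almost sure events -/

theorem theorem3p1 (d : ℕ) (hd : 1 ≤ d) (ρ : ℝ) (hρ : 0 < ρ) (hρ_one : ρ ≤ 1)
    {Ω : Type*} [MeasurableSpace Ω] (P : Measure Ω) [IsProbabilityMeasure P]
    (kind : FrozenMajority.Site d → Ω → FrozenMajority.VertexKind)
    (ring : FrozenMajority.Site d → ℕ → Ω → ℝ≥0)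
    (coin : FrozenMajority.Site d → ℕ → Ω → ℤˣ)
    (henv : FrozenMajority.IsDisorderedEnvironment P d ρ 0 kind ring coin) :
    ∀ᵐ ω ∂P, ∀ σ₀ : FrozenMajority.Config d,
      (∃! σ : ℝ≥0 → FrozenMajority.Config d,
        FrozenMajority.IsTrajectory (fun x => kind x ω) (fun x k => ring x k ω)
          (fun x k => coin x k ω) σ₀ σ) ∧
      ∀ σ : ℝ≥0 → FrozenMajority.Config d,
        FrozenMajority.IsTrajectory (fun x => kind x ω) (fun x k => ring x k ω)
          (fun x k => coin x k ω) σ₀ σ →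
        FrozenMajority.FixatesToPlus σ := by
  have hX : ∀ x, Measurable fun ω => kind x ω = FrozenMajority.VertexKind.frozenPlus := fun x =>
    (Measurable.of_discrete (f := fun k => k = FrozenMajority.VertexKind.frozenPlus)).comp
      (henv.measurable_kind x)
  have hXind : iIndepFun (fun x ω => kind x ω = FrozenMajority.VertexKind.frozenPlus) P :=
    henv.indep_kind.comp (fun _ k => k = FrozenMajority.VertexKind.frozenPlus)
      fun _ => Measurable.of_discrete
  have hminus : ∀ x, ∀ᵐ ω ∂P, kind x ω ≠ FrozenMajority.VertexKind.frozenMinus := fun x => by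
    have h := henv.prob_minus x
    rw [measureReal_def, ENNReal.toReal_eq_zero_iff] at h
    simpa [ae_iff] using h.resolve_right (measure_ne_top _ _)
  have hwin := fun n m => FrozenMajority.ae_exists_isFillingWindow henv.clock henv.indep_clock
    henv.measurable_coin henv.fair_coin henv.indep_coin henv.indep_clock_coin
    (FrozenMajority.finite_cube _ _ _ : (FrozenMajority.box d n).Finite).toFinset m
  simp only [Set.Finite.coe_toFinset] at hwin
  -- `σ₀` is introduced only after the null sets are discarded, which gives the statement for all
  -- initial configurations at once.
  filter_upwards [FrozenMajority.ae_regularClocks henv.clock henv.indep_clock,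
    FrozenMajority.ae_exists_spanned_box hd hX hXind hρ henv.prob_plus, ae_all_iff.2 hminus,
    ae_all_iff.2 fun n => ae_all_iff.2 (hwin n)] with ω hr hbox hkind hω σ₀
  obtain ⟨σ, hσ⟩ := hr.exists_isTrajectory (fun x => kind x ω) (fun x k => coin x k ω) σ₀
  exact ⟨⟨σ, hσ, fun σ' hσ' => hr.trajectory_unique hσ' hσ⟩,
    fun σ' hσ' => hσ'.fixatesToPlus hr hkind hbox hω⟩
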